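/- Let $G$ be a compact Lie group with Lie algebra $\mathfrak g$, and let $U$ and $V$ be strongly continuous unitary representations of $G$ on complex Hilbert spaces $\mathcal H$ and $\mathcal K$. Let $\psi\in\mathcal H$ and $\phi\in\mathcal K$ be unit vectors and let $R>0$. A quantum channel (a linear, completely positive, trace-preserving map $\mathcal E$ between trace-class operators) is $G$-covariant if $\mathcal E(U_{\rm in}(g)\,\cdot\,U_{\rm in}(g)^\dagger)=U_{\rm out}(g)\,\mathcal E(\cdot)\,U_{\rm out}(g)^\dagger$ for all $g\in G$. There is an asymptotic $G$-covariant transformation from $\psi$ to $\phi$ at rate $R$ if for every $N\in\mathbb N$ there are a density operator $\sigma_N$ on $\mathcal K^{\otimes M(N)}$, $M(N)=\lfloor NR\rfloor$, and a $G$-covariant channel (for the representations $U^{\otimes N}$ and $V^{\otimes M(N)}$) taking $|\psi\rangle\langle\psi|^{\otimes N}$ to $\sigma_N$, such that $\lim_{N\to\infty}\mathrm{Fid}(\sigma_N,|\phi\rangle\langle\phi|^{\otimes M(N)})=1$, where $\mathrm{Fid}(\rho,\sigma)=\mathrm{tr}\sqrt{\sqrt\sigma\,\rho\,\sqrt\sigma}$.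 It is reversible if moreover there is an asymptotic $G$-covariant transformation from $\phi$ to $\psi$ at rate $R^{-1}$. Suppose there is a reversible asymptotic $G$-covariant transformation between $\psi$ and $\phi$ at rate $R$. Then: (i) $\mathrm{Sym}_G(\psi)=\mathrm{Sym}_G(\phi)$, where $\mathrm{Sym}_G(\psi)=\{g\in G: U(g)|\psi\rangle\langle\psi|U(g)^\dagger=|\psi\rangle\langle\psi|\}$, and likewise for $\phi$ with $V$. Assume in addition that $\psi$ and $\phi$ lie in the common domain of the generators of the respective representation, i.e. that $g\mapsto U(g)\psi$ and $g\mapsto V(g)\phi$ are differentiable at the identity (which is automatic for finite-dimensional representations). For $X\in\mathfrak g$ let $L_X$ be the corresponding generator, $L_X\psi=-i\,\frac{d}{dt}\big|_{t=0}U(e^{tX})\psi$, put $\langle L_X\rangle_\psi=\langle\psi|L_X|\psi\rangle$, and use the same notation for $\phi$ and $V$. Then: (ii) for every basis $(X_k)$ of $\mathfrak g$, with $L_k=L_{X_k}$ and $[C_{\mathfrak g}(\psi)]_{kl}=\tfrac12\big(\langle L_k\psi|L_l\psi\rangle+\langle L_l\psi|L_k\psi\rangle\big)-\langle L_k\rangle_\psi\langle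 L_l\rangle_\psi$ (that is, $\tfrac12\langle\psi|L_kL_l+L_lL_k|\psi\rangle-\langle\psi|L_k|\psi\rangle\langle\psi|L_l|\psi\rangle$), one has $C_{\mathfrak g}(\psi)=R\,C_{\mathfrak g}(\phi)$; (iii) $\langle L_X\rangle_\psi=R\,\langle L_X\rangle_\phi$ for every $X$ in the commutator subalgebra $[\mathfrak g,\mathfrak g]$. -/

import Mathlib

open Filter Topology
open scoped TensorProduct Manifold ContDiff

namespace Asymmetry

universe u v w

noncomputable section

/-! ### Trace-class operators, density operators, channels, fidelity -/

section Operators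

variable {A : Type u} [NormedAddCommGroup A] [InnerProductSpace ℂ A] [CompleteSpace A]
variable {B : Type w} [NormedAddCommGroup B] [InnerProductSpace ℂ B] [CompleteSpace B]

/-- A positive operator with finite trace. -/
def IsPosTraceClass (T : A →L[ℂ] A) : Prop :=
  T.IsPositive ∧ ∀ (ι : Type u) (b : HilbertBasis ι ℂ A),
    Summable fun i => inner ℂ (b i) (T (b i))

variable (A) in
/-- The trace-class operators: linear combinations of positive operators with finite trace. -/
def traceClass : Submodule ℂ (A →L[ℂ] A) :=
  Submodule.span ℂ {T | IsPosTraceClass T}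

variable (A) in
/-- An index set of an orthonormal basis of `A`. -/
def basisSet : Set A := (exists_hilbertBasis ℂ A).choose

variable (A) in
/-- An orthonormal basis of `A`. -/
def someBasis : HilbertBasis (basisSet A) ℂ A :=
  (exists_hilbertBasis ℂ A).choose_spec.choose

/-- The trace of an operator (on trace-class operators it does not depend on the basis). -/
def tr (T : A →L[ℂ] A) : ℂ :=
  ∑' i, inner ℂ (someBasis A i) (T (someBasis A i))

open scoped ComplexOrder in
/-- Positivity of the operator `∑ i j, |i⟩⟨j| ⊗ T i j` on `ℂⁿ ⊗ A`. -/
def BlockPositive {n : ℕ} (T : Fin n → Fin n → (A →L[ℂ] A)) : Prop :=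
  ∀ x : Fin n → A, 0 ≤ ∑ i, ∑ j, inner ℂ (x i) (T i j (x j))

variable (A B) in
/-- A quantum channel: a linear, completely positive, trace-preserving map from the trace-class
operators on `A` to the trace-class operators on `B`. -/
structure Channel where
  map : traceClass A →ₗ[ℂ] traceClass B
  completelyPositive : ∀ (n : ℕ) (T : Fin n → Fin n → traceClass A),
    BlockPositive (fun i j => (T i j : A →L[ℂ] A)) →
      BlockPositive (fun i j => (map (T i j) : B →L[ℂ] B))
  tracePreserving : ∀ T : traceClass A, tr (map T : B →L[ℂ] B) = tr (T : A →L[ℂ] A)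

variable (A) in
/-- A density operator: a positive operator of trace one. -/
structure DensityOp where
  op : A →L[ℂ] A
  isPosTraceClass : IsPosTraceClass op
  tr_eq_one : tr op = 1

/-- A density operator as a trace-class operator. -/
def DensityOp.toTraceClass (ρ : DensityOp A) : traceClass A :=
  ⟨ρ.op, Submodule.subset_span ρ.isPosTraceClass⟩

/-- The fidelity `tr √(√σ ρ √σ)` of two states. -/
def fid (ρ σ : DensityOp A) : ℝ :=
  (tr (CFC.sqrt (CFC.sqrt σ.op * ρ.op * CFC.sqrt σ.op))).re

/-- Conjugation `T ↦ u T u†` by a unitary operator. -/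
def conj (u : A ≃ₗᵢ[ℂ] A) (T : A →L[ℂ] A) : A →L[ℂ] A :=
  (u.toContinuousLinearEquiv : A →L[ℂ] A) ∘L T ∘L
    ContinuousLinearMap.adjoint (u.toContinuousLinearEquiv : A →L[ℂ] A)

theorem conj_apply (u : A ≃ₗᵢ[ℂ] A) (T : A →L[ℂ] A) (x : A) :
    conj u T x = u (T (u.symm x)) := by
  have h : ContinuousLinearMap.adjoint (u.toContinuousLinearEquiv : A →L[ℂ] A) x
      = u.symm x := by
    refine ext_inner_left ℂ fun y => ?_
    rw [ContinuousLinearMap.adjoint_inner_right]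
    rw [← u.inner_map_map y (u.symm x)]
    simp
  change u (T (ContinuousLinearMap.adjoint (u.toContinuousLinearEquiv : A →L[ℂ] A) x)) = _
  rw [h]

theorem isPosTraceClass_conj (u : A ≃ₗᵢ[ℂ] A) {T : A →L[ℂ] A} (hT : IsPosTraceClass T) :
    IsPosTraceClass (conj u T) := by
  refine ⟨hT.1.conj_adjoint (u.toContinuousLinearEquiv : A →L[ℂ] A), fun ι b => ?_⟩
  have ho : Orthonormal ℂ (fun i => u.symm (b i)) :=
    b.orthonormal.comp_linearIsometry u.symm.toLinearIsometry
  have h := hT.2 ι (HilbertBasis.mk ho (by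
      have hb := b.dense_span
      have hr : Set.range (fun i => u.symm (b i)) = u.symm '' Set.range b := by
        rw [← Set.range_comp]; rfl
      intro x _
      rw [hr]
      have h1 : u x ∈ closure ((Submodule.span ℂ (Set.range b) : Submodule ℂ A) : Set A) := by
        rw [← Submodule.topologicalClosure_coe, hb]; trivial
      have h2 : u.symm (u x) ∈ u.symm '' closure
          ((Submodule.span ℂ (Set.range b) : Submodule ℂ A) : Set A) := ⟨_, h1, rfl⟩
      have h3 := image_closure_subset_closure_image u.symm.continuous h2
      rw [u.symm_apply_apply] at h3
      change x ∈ closure _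
      convert h3 using 2
      ext z
      have h4 := Submodule.map_span (u.symm.toLinearEquiv : A →ₗ[ℂ] A) (Set.range b)
      have h5 := congrArg (fun S : Submodule ℂ A => z ∈ S) h4
      simp only [Submodule.mem_map] at h5
      exact (iff_of_eq h5).symm))
  refine h.congr fun i => ?_
  rw [HilbertBasis.coe_mk, conj_apply, ← u.inner_map_map]
  simp

theorem conj_mem_traceClass (u : A ≃ₗᵢ[ℂ] A) (T : traceClass A) :
    conj u (T : A →L[ℂ] A) ∈ traceClass A := by
  obtain ⟨T, hT⟩ := T
  change conj u T ∈ traceClass A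
  induction hT using Submodule.span_induction with
  | mem x hx => exact Submodule.subset_span (isPosTraceClass_conj u hx)
  | zero => simp [conj]
  | add x y _ _ hx hy =>
    have : conj u (x + y) = conj u x + conj u y := by ext z; simp [conj]
    rw [this]; exact Submodule.add_mem _ hx hy
  | smul c x _ hx =>
    have : conj u (c • x) = c • conj u x := by ext z; simp [conj]
    rw [this]; exact Submodule.smul_mem _ _ hx

/-- Conjugation by a unitary operator on the trace-class operators. -/
def conjTC (u : A ≃ₗᵢ[ℂ] A) (T : traceClass A) : traceClass A :=
  ⟨conj u T, conj_mem_traceClass u T⟩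

theorem hasSum_rankOne (ψ : A) {ι : Type*} (b : HilbertBasis ι ℂ A) :
    HasSum (fun i => inner ℂ (b i) (InnerProductSpace.rankOne ℂ ψ ψ (b i))) (inner ℂ ψ ψ) := by
  have h : (fun i => inner ℂ (b i) (InnerProductSpace.rankOne ℂ ψ ψ (b i)))
      = fun i => inner ℂ ψ (b i) * inner ℂ (b i) ψ := by
    funext i
    rw [InnerProductSpace.rankOne_apply, inner_smul_right]
  rw [h]
  exact b.hasSum_inner_mul_inner ψ ψ

/-- The density operator `|ψ⟩⟨ψ|` of a unit vector. -/
def pureState (ψ : A) (hψ : ‖ψ‖ = 1) : DensityOp A where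
  op := InnerProductSpace.rankOne ℂ ψ ψ
  isPosTraceClass := ⟨InnerProductSpace.isPositive_rankOne_self ψ,
    fun _ b => (hasSum_rankOne ψ b).summable⟩
  tr_eq_one := by
    rw [tr, (hasSum_rankOne ψ (someBasis A)).tsum_eq, inner_self_eq_norm_sq_to_K, hψ]
    simp

end Operators

/-! ### Hilbert spaces with a unitary group action and their tensor powers -/

/-- A complex Hilbert space with an action of `G` by unitary operators. -/
structure System (G : Type v) [Group G] where
  carrier : Type u
  [normedAddCommGroup : NormedAddCommGroup carrier]
  [innerProductSpace : InnerProductSpace ℂ carrier]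
  [completeSpace : CompleteSpace carrier]
  U : G →* (carrier ≃ₗᵢ[ℂ] carrier)

attribute [instance] System.normedAddCommGroup System.innerProductSpace System.completeSpace

section Completion

variable {V : Type*} [NormedAddCommGroup V] [InnerProductSpace ℂ V]

/-- The extension of a unitary operator of an inner product space to the completion. -/
def completionIso (f : V ≃ₗᵢ[ℂ] V) :
    UniformSpace.Completion V ≃ₗᵢ[ℂ] UniformSpace.Completion V where
  toFun := (f.toContinuousLinearEquiv : V →L[ℂ] V).completion
  invFun := (f.symm.toContinuousLinearEquiv : V →L[ℂ] V).completion
  map_add' := map_add _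
  map_smul' := map_smul _
  left_inv x := by
    induction x using UniformSpace.Completion.induction_on with
    | hp => exact isClosed_eq (by fun_prop) (by fun_prop)
    | ih a => simp
  right_inv x := by
    induction x using UniformSpace.Completion.induction_on with
    | hp => exact isClosed_eq (by fun_prop) (by fun_prop)
    | ih a => simp
  norm_map' x := by
    induction x using UniformSpace.Completion.induction_on with
    | hp =>
      exact isClosed_eq
        ((f.toContinuousLinearEquiv : V →L[ℂ] V).completion.continuous.norm) continuous_norm
    | ih a =>
      change ‖(f.toContinuousLinearEquiv : V →L[ℂ] V).completion a‖ = _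
      simp

theorem completionIso_coe (f : V ≃ₗᵢ[ℂ] V) (x : V) :
    completionIso f (x : UniformSpace.Completion V) = ((f x : V) : UniformSpace.Completion V) :=
  ContinuousLinearMap.completion_apply_coe _ x

theorem completionIso_one : completionIso (1 : V ≃ₗᵢ[ℂ] V) = 1 := by
  ext x
  induction x using UniformSpace.Completion.induction_on with
  | hp => exact isClosed_eq (completionIso 1).continuous continuous_id
  | ih a => rw [completionIso_coe]; rfl

theorem completionIso_mul (f g : V ≃ₗᵢ[ℂ] V) :
    completionIso (f * g) = completionIso f * completionIso g := by
  ext x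
  induction x using UniformSpace.Completion.induction_on with
  | hp =>
    exact isClosed_eq (completionIso (f * g)).continuous
      (completionIso f * completionIso g).continuous
  | ih a =>
    change _ = completionIso f (completionIso g a)
    simp only [completionIso_coe]
    rfl

end Completion

variable {G : Type v} [Group G]

/-- The one-dimensional system with trivial action. -/
def System.unit (G : Type v) [Group G] : System.{u, v} G where
  carrier := EuclideanSpace ℂ PUnit.{u + 1}
  U := 1

/-- The (completed) tensor product of two systems, with action `U(g) ⊗ V(g)`. -/
def System.tensor (S T : System.{u, v} G) : System.{u, v} G where
  carrier := UniformSpace.Completion (S.carrier ⊗[ℂ] T.carrier)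
  U :=
    { toFun := fun g => completionIso (TensorProduct.congrIsometry (S.U g) (T.U g))
      map_one' := by
        rw [← completionIso_one]
        congr 1
        simp only [map_one]
        exact TensorProduct.congrIsometry_refl_refl
      map_mul' := fun g h => by
        rw [← completionIso_mul]
        congr 1
        simp only [map_mul]
        ext x
        induction x using TensorProduct.induction_on with
        | zero => simp
        | tmul a b => rfl
        | add a b ha hb => simp only [map_add, ha, hb] }

/-- The tensor power of a system. -/
def System.power (S : System.{u, v} G) : ℕ → System.{u, v} G
  | 0 => System.unit G
  | n + 1 => (S.power n).tensor S

/-- The vector `ψ ⊗ ⋯ ⊗ ψ` in the tensor power. -/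
def System.powerVec (S : System.{u, v} G) (ψ : S.carrier) : (n : ℕ) → (S.power n).carrier
  | 0 => (EuclideanSpace.single PUnit.unit 1 : EuclideanSpace ℂ PUnit.{u + 1})
  | n + 1 => ((S.powerVec ψ n ⊗ₜ[ℂ] ψ : (S.power n).carrier ⊗[ℂ] S.carrier) :
      UniformSpace.Completion ((S.power n).carrier ⊗[ℂ] S.carrier))

theorem System.norm_powerVec (S : System.{u, v} G) {ψ : S.carrier} (hψ : ‖ψ‖ = 1) (n : ℕ) :
    ‖S.powerVec ψ n‖ = 1 := by
  induction n with
  | zero =>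
    change ‖(EuclideanSpace.single PUnit.unit 1 : EuclideanSpace ℂ PUnit.{u + 1})‖ = 1
    simp
  | succ n ih =>
    change ‖((S.powerVec ψ n ⊗ₜ[ℂ] ψ : (S.power n).carrier ⊗[ℂ] S.carrier) :
      UniformSpace.Completion ((S.power n).carrier ⊗[ℂ] S.carrier))‖ = 1
    rw [UniformSpace.Completion.norm_coe, TensorProduct.norm_tmul, ih, hψ, mul_one]

/-- The state `ψ^{⊗ n}`. -/
def System.powerState (S : System.{u, v} G) (ψ : S.carrier) (hψ : ‖ψ‖ = 1) (n : ℕ) :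
    DensityOp (S.power n).carrier :=
  pureState (S.powerVec ψ n) (S.norm_powerVec hψ n)

/-! ### Covariant transformations -/

/-- A channel is `G`-covariant if `ℰ(U(g) T U(g)†) = V(g) ℰ(T) V(g)†` for all `g`. -/
def IsCovariant (S : System.{u, v} G) (T : System.{w, v} G) (E : Channel S.carrier T.carrier) : Prop :=
  ∀ (g : G) (X : traceClass S.carrier), E.map (conjTC (S.U g) X) = conjTC (T.U g) (E.map X)

/-- Some `G`-covariant channel takes `ρ` to `σ`. -/
def CovariantlyConvertible (S : System.{u, v} G) (T : System.{w, v} G)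
    (ρ : DensityOp S.carrier) (σ : DensityOp T.carrier) : Prop :=
  ∃ E : Channel S.carrier T.carrier, IsCovariant S T E ∧ E.map ρ.toTraceClass = σ.toTraceClass

/-- There is an asymptotic `G`-covariant transformation from `ψ` to `φ` at rate `R`. -/
def AsymptoticallyConvertible (S : System.{u, v} G) (T : System.{w, v} G) (ψ : S.carrier) (hψ : ‖ψ‖ = 1)
    (φ : T.carrier) (hφ : ‖φ‖ = 1) (R : ℝ) : Prop :=
  ∃ σ : (N : ℕ) → DensityOp (T.power ⌊(N : ℝ) * R⌋₊).carrier,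
    (∀ N : ℕ, CovariantlyConvertible (S.power N) (T.power ⌊(N : ℝ) * R⌋₊)
      (S.powerState ψ hψ N) (σ N)) ∧
    Tendsto (fun N : ℕ => fid (σ N) (T.powerState φ hφ ⌊(N : ℝ) * R⌋₊)) atTop (𝓝 1)

/-- There is a reversible asymptotic `G`-covariant transformation from `ψ` to `φ` at rate `R`. -/
def ReversiblyConvertible (S : System.{u, v} G) (T : System.{w, v} G) (ψ : S.carrier) (hψ : ‖ψ‖ = 1)
    (φ : T.carrier) (hφ : ‖φ‖ = 1) (R : ℝ) : Prop :=
  AsymptoticallyConvertible S T ψ hψ φ hφ R ∧ AsymptoticallyConvertible T S φ hφ ψ hψ R⁻¹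

/-- The symmetries of a state: the `g` with `U(g) ρ U(g)† = ρ`. -/
def sym (S : System.{u, v} G) (ρ : DensityOp S.carrier) : Set G :=
  {g | conj (S.U g) ρ.op = ρ.op}

/-! ### Generators, expectation values and covariance matrices -/

section Lie

/-- A smooth real Lie group is in particular of the class that the Lie bracket needs. -/
instance instLieGroupMinSmoothness {E : Type*} [NormedAddCommGroup E] [NormedSpace ℝ E] {G : Type*} [Group G]
    [TopologicalSpace G] [ChartedSpace E G] [LieGroup 𝓘(ℝ, E) ∞ G] :
    LieGroup 𝓘(ℝ, E) (minSmoothness ℝ 3) G :=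
  LieGroup.of_le (n := ∞) (by
    rw [minSmoothness_of_isRCLikeNormedField]
    exact ENat.LEInfty.out)

variable {E : Type*} [NormedAddCommGroup E] [NormedSpace ℝ E]
  [TopologicalSpace G] [ChartedSpace E G]

variable (E) in
/-- `ψ` lies in the common domain of the generators of the representation: the orbit map
`g ↦ U(g) ψ` is differentiable at the identity. -/
def InGeneratorDomain (S : System.{u, v} G) (ψ : S.carrier) : Prop :=
  MDifferentiableAt 𝓘(ℝ, E) 𝓘(ℝ, S.carrier) (fun g : G => S.U g ψ) 1

/-- The vector `L_X ψ`, where `L_X = -i dU(X)` is the self-adjoint generator of the one-parameter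
group of unitaries that belongs to the Lie algebra element `X`. -/
def genApply (S : System.{u, v} G) (X : GroupLieAlgebra 𝓘(ℝ, E) G) (ψ : S.carrier) : S.carrier :=
  (-Complex.I) • (show S.carrier from
    mfderiv 𝓘(ℝ, E) 𝓘(ℝ, S.carrier) (fun g : G => S.U g ψ) 1 X)

/-- The expectation value `⟨ψ| L_X |ψ⟩`. -/
def expect (S : System.{u, v} G) (X : GroupLieAlgebra 𝓘(ℝ, E) G) (ψ : S.carrier) : ℂ :=
  inner ℂ ψ (genApply S X ψ)

/-- The covariance matrix
`1/2 ⟨ψ| L_k L_l + L_l L_k |ψ⟩ - ⟨ψ| L_k |ψ⟩ ⟨ψ| L_l |ψ⟩`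
for a basis of the Lie algebra; as `L_k` is self-adjoint, `⟨ψ| L_k L_l |ψ⟩` is the inner product of
`L_k ψ` and `L_l ψ`. -/
def covMatrix (S : System.{u, v} G) {κ : Type*} (b : Module.Basis κ ℝ (GroupLieAlgebra 𝓘(ℝ, E) G))
    (ψ : S.carrier) : Matrix κ κ ℂ :=
  Matrix.of fun k l =>
    1 / 2 * (inner ℂ (genApply S (b k) ψ) (genApply S (b l) ψ)
      + inner ℂ (genApply S (b l) ψ) (genApply S (b k) ψ))
      - expect S (b k) ψ * expect S (b l) ψ

end Lie

end

end Asymmetry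

/-!
Write `χ_ψ(g) = ⟨ψ|U(g)|ψ⟩`. For a covariant channel `ℰ` and unit vectors `Ψ`, `Φ`, the function
`f(g) = ⟨V(g)Φ|ℰ(|U(g)Ψ⟩⟨Ψ|)|Φ⟩` is positive definite, because `ℰ` is completely positive and
covariant, and `f(1)` is the squared fidelity of `ℰ(|Ψ⟩⟨Ψ|)` with `Φ`. As `ℰ` preserves the trace,
Cauchy–Schwarz gives `|χ_Ψ(g) - χ_Φ(g) f(g)| ≤ 2 √(1 - f(1))` for all `g`. An asymptotic
transformation thus yields positive definite `f_N` with `|f_N| ≤ 1` and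
`χ_ψ ^ N - χ_φ ^ ⌊N R⌋ f_N → 0` uniformly on `G`.

* If `|χ_ψ(g)| = 1`, then `|χ_φ(g)| = 1`; these are the equations defining the symmetry groups.
* If `g_N → 1` along `X` at speed `1 / √N`, then `|χ_ψ(g_N)| ^ N → exp (-Var_ψ(L_X) / 2)`, whence
  `R Var_φ(L_X) ≤ Var_ψ(L_X)`. The reverse transformation gives equality, and polarization gives
  the covariance matrices.
* Equality of the variances forces `|f_N(g_N)| → 1`. A positive definite function is nearly
  multiplicative where its modulus is nearly `1`, so `f_N → 1` along the commutators of `g_N` and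
  `k_N`, for `k_N → 1` along `Y` at the same speed. These commutators approach `1` along `[X, Y]` at
  speed `1 / N`, where `χ_ψ ^ N → exp (i ⟨L_[X, Y]⟩_ψ)`, and likewise for `φ` with exponent
  `⌊N R⌋`; comparing the limits gives the expectation values on `[𝔤, 𝔤]`.
-/

namespace Asymmetry

universe u v w

noncomputable section

open Complex InnerProductSpace
open scoped ComplexOrder MatrixOrder Matrix

section Gram

variable {n : Type*} [Fintype n]

theorem posSemidef_of_dotProduct_mulVec_nonneg {M : Matrix n n ℂ}
    (hM : ∀ x : n → ℂ, 0 ≤ star x ⬝ᵥ M *ᵥ x) : M.PosSemidef := by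
  classical
  rw [← Matrix.isPositive_toEuclideanLin_iff, LinearMap.isPositive_iff_complex]
  intro x
  have h : 0 ≤ ⟪x, M.toEuclideanLin x⟫_ℂ := by
    rw [EuclideanSpace.inner_eq_star_dotProduct, dotProduct_comm]
    exact hM x.ofLp
  have h' : 0 ≤ ⟪M.toEuclideanLin x, x⟫_ℂ := by
    rwa [← inner_conj_symm, starRingEnd_apply, star_nonneg_iff]
  exact ⟨conj_eq_iff_re.1 (conj_eq_iff_im.2 (Complex.nonneg_iff.1 h').2.symm),
    (Complex.nonneg_iff.1 h').1⟩

theorem exists_eq_gram_of_posSemidef {M : Matrix n n ℂ} (hM : M.PosSemidef) :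
    ∃ v : n → EuclideanSpace ℂ n, M = Matrix.gram ℂ v := by
  classical
  obtain ⟨C, hC⟩ := CStarAlgebra.nonneg_iff_eq_star_mul_self.1 hM.nonneg
  refine ⟨fun i => WithLp.toLp 2 fun k => C k i, ?_⟩
  ext i j
  simp [hC, Matrix.mul_apply, Matrix.gram_apply, PiLp.inner_apply, mul_comm]

end Gram

section Block

variable {A : Type u} [NormedAddCommGroup A] [InnerProductSpace ℂ A]

theorem BlockPositive.posSemidef {n : ℕ} {T : Fin n → Fin n → (A →L[ℂ] A)}
    (hT : BlockPositive T) (x : Fin n → A) :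
    (Matrix.of fun i j => ⟪x i, T i j (x j)⟫_ℂ).PosSemidef := by
  refine posSemidef_of_dotProduct_mulVec_nonneg fun c => ?_
  convert hT fun i => c i • x i using 1
  simp only [dotProduct, Matrix.mulVec, Finset.mul_sum, Pi.star_apply, Matrix.of_apply,
    RCLike.star_def, map_smul, inner_smul_left, inner_smul_right]
  exact Finset.sum_congr rfl fun i _ => Finset.sum_congr rfl fun j _ => by ring

theorem BlockPositive.re_inner_nonneg {n : ℕ} {T : Fin n → Fin n → (A →L[ℂ] A)}
    (hT : BlockPositive T) (i : Fin n) (x : A) : 0 ≤ (⟪x, T i i x⟫_ℂ).re :=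
  (Complex.nonneg_iff.1 (hT.posSemidef fun _ => x).diag_nonneg).1

theorem BlockPositive.norm_inner_le {n : ℕ} {T : Fin n → Fin n → (A →L[ℂ] A)}
    (hT : BlockPositive T) {i j : Fin n} (hij : i ≠ j) (x y : A) :
    ‖⟪x, T i j y⟫_ℂ‖ ≤ √(⟪x, T i i x⟫_ℂ).re * √(⟪y, T j j y⟫_ℂ).re := by
  obtain ⟨v, hv⟩ := exists_eq_gram_of_posSemidef
    (hT.posSemidef (Function.update (fun _ => y) i x))
  have entry : ∀ k l, ⟪Function.update (fun _ => y) i x k,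
      T k l (Function.update (fun _ => y) i x l)⟫_ℂ = ⟪v k, v l⟫_ℂ :=
    fun k l => congrFun (congrFun hv k) l
  have hij' := entry i j
  have hi := congrArg re (entry i i)
  have hj := congrArg re (entry j j)
  simp only [Function.update_self, Function.update_of_ne hij.symm] at hij' hi hj
  rw [hij', hi, hj]
  simpa only [← RCLike.re_eq_complex_re, ← norm_eq_sqrt_re_inner] using norm_inner_le_norm _ _

end Block

section Trace

variable {A : Type u} [NormedAddCommGroup A] [InnerProductSpace ℂ A] [CompleteSpace A]

theorem rankOne_self_mem_traceClass (x : A) : rankOne ℂ x x ∈ traceClass A :=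
  Submodule.subset_span ⟨isPositive_rankOne_self x, fun _ b => (hasSum_rankOne x b).summable⟩

theorem rankOne_mem_traceClass (x y : A) : rankOne ℂ x y ∈ traceClass A := by
  have polarization : rankOne ℂ x y = (1 / 4 : ℂ) •
      (rankOne ℂ (x + y) (x + y) - rankOne ℂ (x - y) (x - y)
        + I • rankOne ℂ (x + I • y) (x + I • y) - I • rankOne ℂ (x - I • y) (x - I • y)) := by
    ext z
    simp only [rankOne_apply, smul_apply, add_apply, sub_apply, inner_add_left, inner_sub_left,
      inner_smul_left, conj_I]
    match_scalars <;> ring_nf <;> simp only [I_sq] <;> ring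
  rw [polarization]
  have hself := rankOne_self_mem_traceClass (A := A)
  exact Submodule.smul_mem _ _ <| sub_mem (add_mem (sub_mem (hself _) (hself _))
    (Submodule.smul_mem _ _ (hself _))) (Submodule.smul_mem _ _ (hself _))

/-- The operator `|x⟩⟨y|` as a trace-class operator. -/
def ketBra (x y : A) : traceClass A :=
  ⟨rankOne ℂ x y, rankOne_mem_traceClass x y⟩

theorem conjTC_ketBra (u : A ≃ₗᵢ[ℂ] A) (x y : A) :
    conjTC u (ketBra x y) = ketBra (u x) (u y) := by
  refine Subtype.ext (ContinuousLinearMap.ext fun z => ?_)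
  change conj u (rankOne ℂ x y) z = rankOne ℂ (u x) (u y) z
  rw [conj_apply, rankOne_apply, rankOne_apply, map_smul, ← u.inner_map_map y, u.apply_symm_apply]

theorem tr_rankOne (x y : A) : tr (rankOne ℂ x y) = ⟪y, x⟫_ℂ := by
  simp only [tr, rankOne_apply, inner_smul_right]
  exact (someBasis A).tsum_inner_mul_inner y x

theorem tr_smul (c : ℂ) (T : A →L[ℂ] A) : tr (c • T) = c * tr T := by
  simp only [tr, smul_apply, inner_smul_right, tsum_mul_left]

theorem hasSum_tr {T : A →L[ℂ] A} (hT : T ∈ traceClass A) :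
    HasSum (fun i => ⟪someBasis A i, T (someBasis A i)⟫_ℂ) (tr T) := by
  refine Summable.hasSum ?_
  induction hT using Submodule.span_induction with
  | mem T hT => exact hT.2 _ _
  | zero => simp
  | add T K _ _ hT hK => simpa only [add_apply, inner_add_right] using hT.add hK
  | smul c T _ hT => simpa only [smul_apply, inner_smul_right] using hT.mul_left c

theorem blockPositive_ketBra {n : ℕ} (v : Fin n → A) :
    BlockPositive (fun i j => (ketBra (v i) (v j) : A →L[ℂ] A)) := by
  intro x
  have square : ∑ i, ∑ j, ⟪x i, (ketBra (v i) (v j) : A →L[ℂ] A) (x j)⟫_ℂ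
      = starRingEnd ℂ (∑ i, ⟪v i, x i⟫_ℂ) * ∑ j, ⟪v j, x j⟫_ℂ := by
    simp only [ketBra, rankOne_apply, inner_smul_right, map_sum, inner_conj_symm,
      Finset.sum_mul_sum, mul_comm ⟪x _, _⟫_ℂ]
  rw [square, ← normSq_eq_conj_mul_self]
  exact_mod_cast normSq_nonneg _

end Trace

section OffDiagonal

variable {A : Type u} [NormedAddCommGroup A] [InnerProductSpace ℂ A]

theorem hasSum_inner_compress {ι : Type*} (b : HilbertBasis ι ℂ A) (T : A →L[ℂ] A) (p q : A) :
    HasSum (fun i => ⟪⟪p, b i⟫_ℂ • p, T (⟪q, b i⟫_ℂ • q)⟫_ℂ) (⟪q, p⟫_ℂ * ⟪p, T q⟫_ℂ) := by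
  refine ((b.hasSum_inner_mul_inner q p).mul_right _).congr_fun fun i => ?_
  rw [inner_smul_left, map_smul, inner_smul_right, inner_conj_symm]
  ring

theorem hasSum_inner_sub_inner_smul [CompleteSpace A] {ι : Type*} (b : HilbertBasis ι ℂ A)
    {T : A →L[ℂ] A} {p : A} (hp : ‖p‖ = 1) {s : ℂ}
    (hT : HasSum (fun i => ⟪b i, T (b i)⟫_ℂ) s) :
    HasSum (fun i => ⟪b i - ⟪p, b i⟫_ℂ • p, T (b i - ⟪p, b i⟫_ℂ • p)⟫_ℂ) (s - ⟪p, T p⟫_ℂ) := by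
  have hleft := b.hasSum_inner_mul_inner p (T p)
  have hright := b.hasSum_inner_mul_inner (ContinuousLinearMap.adjoint T p) p
  have hboth := hasSum_inner_compress b T p p
  rw [ContinuousLinearMap.adjoint_inner_left] at hright
  rw [inner_self_eq_one_of_norm_eq_one hp, one_mul] at hboth
  have hsum := ((hT.sub hleft).sub hright).add hboth
  rw [sub_add_cancel] at hsum
  refine hsum.congr_fun fun i => ?_
  simp only [map_sub, inner_sub_left, inner_sub_right, map_smul, inner_smul_left,
    inner_smul_right, inner_conj_symm, ContinuousLinearMap.adjoint_inner_left]
  ring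

theorem BlockPositive.summable_and_norm_tsum_inner_le {n : ℕ} {T : Fin n → Fin n → (A →L[ℂ] A)}
    (hT : BlockPositive T) {i j : Fin n} (hij : i ≠ j) {ι : Type*} {x y : ι → A} {a b : ℝ}
    (hx : HasSum (fun k => (⟪x k, T i i (x k)⟫_ℂ).re) a)
    (hy : HasSum (fun k => (⟪y k, T j j (y k)⟫_ℂ).re) b) :
    Summable (fun k => ⟪x k, T i j (y k)⟫_ℂ) ∧ ‖∑' k, ⟪x k, T i j (y k)⟫_ℂ‖ ≤ √a * √b := by
  have hx0 := fun k => hT.re_inner_nonneg i (x k)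
  have hy0 := fun k => hT.re_inner_nonneg j (y k)
  obtain ⟨C, -, hC, hsum⟩ := Real.inner_le_Lp_mul_Lq_hasSum_of_nonneg .two_two
    (Real.sqrt_nonneg a) (Real.sqrt_nonneg b)
    (fun k => Real.sqrt_nonneg (⟪x k, T i i (x k)⟫_ℂ).re)
    (fun k => Real.sqrt_nonneg (⟪y k, T j j (y k)⟫_ℂ).re)
    (by simpa only [Real.rpow_two, Real.sq_sqrt (hx0 _), Real.sq_sqrt (hx.nonneg hx0)] using hx)
    (by simpa only [Real.rpow_two, Real.sq_sqrt (hy0 _), Real.sq_sqrt (hy.nonneg hy0)] using hy)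
  have hle := fun k => hT.norm_inner_le hij (x k) (y k)
  exact ⟨.of_norm_bounded hsum.summable hle, (tsum_of_norm_bounded hsum hle).trans hC⟩

theorem BlockPositive.norm_tr_sub_le [CompleteSpace A] {n : ℕ} {T : Fin n → Fin n → traceClass A}
    (hT : BlockPositive fun i j => (T i j : A →L[ℂ] A)) {i j : Fin n} (hij : i ≠ j) {p q : A}
    (hp : ‖p‖ = 1) (hq : ‖q‖ = 1) :
    ‖tr (T i j : A →L[ℂ] A) - ⟪q, p⟫_ℂ * ⟪p, (T i j : A →L[ℂ] A) q⟫_ℂ‖ ≤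
      √(tr (T i i : A →L[ℂ] A) - ⟪p, (T i i : A →L[ℂ] A) p⟫_ℂ).re *
          √(tr (T j j : A →L[ℂ] A)).re +
        √(⟪p, (T i i : A →L[ℂ] A) p⟫_ℂ).re *
          √(tr (T j j : A →L[ℂ] A) - ⟪q, (T j j : A →L[ℂ] A) q⟫_ℂ).re := by
  -- Insert `1 = (1 - |p⟩⟨p|) + |p⟩⟨p|` on the left of `T i j`, and likewise for `q` on the right of
  -- `|p⟩⟨p| T i j`: the `p`-`q` corner is the subtracted term, and Cauchy–Schwarz bounds the rest.
  set b := someBasis A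
  have hpp := hasSum_inner_compress b (T i i : A →L[ℂ] A) p p
  rw [inner_self_eq_one_of_norm_eq_one hp, one_mul] at hpp
  obtain ⟨hs₁, hle₁⟩ := hT.summable_and_norm_tsum_inner_le hij
    (hasSum_re (hasSum_inner_sub_inner_smul b hp (hasSum_tr (T i i).2)))
    (hasSum_re (hasSum_tr (T j j).2))
  obtain ⟨hs₂, hle₂⟩ := hT.summable_and_norm_tsum_inner_le hij (hasSum_re hpp)
    (hasSum_re (hasSum_inner_sub_inner_smul b hq (hasSum_tr (T j j).2)))
  have split : HasSum (fun k => ⟪b k, (T i j : A →L[ℂ] A) (b k)⟫_ℂ) _ :=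
    ((hs₁.hasSum.add hs₂.hasSum).add
      (hasSum_inner_compress b (T i j : A →L[ℂ] A) p q)).congr_fun fun k => by
        simp only [map_sub, inner_sub_left, inner_sub_right]
        ring
  rw [(hasSum_tr (T i j).2).unique split, add_sub_cancel_right]
  exact (norm_add_le _ _).trans (add_le_add hle₁ hle₂)

end OffDiagonal

section Fidelity

variable {A : Type u} [NormedAddCommGroup A] [InnerProductSpace ℂ A] [CompleteSpace A]

theorem DensityOp.inner_nonneg (σ : DensityOp A) (x : A) : 0 ≤ ⟪x, σ.op x⟫_ℂ :=
  σ.isPosTraceClass.1.inner_nonneg_right x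

theorem DensityOp.ofReal_re_inner (σ : DensityOp A) (x : A) :
    ((⟪x, σ.op x⟫_ℂ).re : ℂ) = ⟪x, σ.op x⟫_ℂ :=
  (eq_re_of_ofReal_le (σ.inner_nonneg x)).symm

theorem DensityOp.re_inner_le_one (σ : DensityOp A) {p : A} (hp : ‖p‖ = 1) :
    (⟪p, σ.op p⟫_ℂ).re ≤ 1 := by
  have hcomplement := hasSum_re (hasSum_inner_sub_inner_smul (someBasis A) hp
    (hasSum_tr σ.toTraceClass.2))
  have hnonneg := hcomplement.nonneg fun i => (Complex.nonneg_iff.1 (σ.inner_nonneg _)).1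
  rw [sub_re, DensityOp.toTraceClass, σ.tr_eq_one, one_re] at hnonneg
  exact sub_nonneg.1 hnonneg

theorem sqrt_smul_of_isStarProjection {P : A →L[ℂ] A} (hP : IsStarProjection P) {r : ℝ}
    (hr : 0 ≤ r) : CFC.sqrt ((r : ℂ) • P) = ((√r : ℝ) : ℂ) • P := by
  refine CFC.sqrt_unique ?_ (smul_nonneg (by exact_mod_cast Real.sqrt_nonneg r) hP.nonneg)
  rw [smul_mul_smul_comm, hP.isIdempotentElem.eq, ← ofReal_mul, Real.mul_self_sqrt hr]

theorem fid_pureState (σ : DensityOp A) {p : A} (hp : ‖p‖ = 1) :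
    fid σ (pureState p hp) = √(⟪p, σ.op p⟫_ℂ).re := by
  have hP : IsStarProjection (rankOne ℂ p p) := isStarProjection_rankOne_self hp
  have hsqrt : CFC.sqrt (rankOne ℂ p p) = rankOne ℂ p p := by
    simpa using sqrt_smul_of_isStarProjection hP zero_le_one
  have compress : rankOne ℂ p p * σ.op * rankOne ℂ p p
      = ((⟪p, σ.op p⟫_ℂ).re : ℂ) • rankOne ℂ p p := by
    ext z
    simp [smul_smul, mul_comm, σ.ofReal_re_inner]
  rw [fid, pureState, hsqrt, compress,
    sqrt_smul_of_isStarProjection hP (Complex.nonneg_iff.1 (σ.inner_nonneg p)).1, tr_smul,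
    tr_rankOne, inner_self_eq_one_of_norm_eq_one hp, mul_one, ofReal_re]

end Fidelity

section PositiveDefinite

variable {G : Type v} [Group G]

/-- A positive definite function on a group: all matrices `f (gᵢ⁻¹ gⱼ)` are positive
semidefinite. -/
def IsPosDefFun (f : G → ℂ) : Prop :=
  ∀ (n : ℕ) (g : Fin n → G), (Matrix.of fun i j => f ((g i)⁻¹ * g j)).PosSemidef

theorem norm_inner_sub_mul_inner_le {H : Type*} [NormedAddCommGroup H] [InnerProductSpace ℂ H]
    {x y z : H} (hx : ‖x‖ ≤ 1) (hy : ‖y‖ ≤ 1) (hz : ‖z‖ ≤ 1) :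
    ‖⟪x, z⟫_ℂ - ⟪x, y⟫_ℂ * ⟪y, z⟫_ℂ‖ ≤ √(1 - ‖⟪x, y⟫_ℂ‖ ^ 2) := by
  have hperp : ‖x - ⟪y, x⟫_ℂ • y‖ ≤ √(1 - ‖⟪x, y⟫_ℂ‖ ^ 2) := by
    apply Real.le_sqrt_of_sq_le
    rw [norm_sub_sq (𝕜 := ℂ), inner_smul_right, inner_mul_symm_re_eq_norm, norm_smul, norm_mul,
      norm_inner_symm y x]
    nlinarith [sq_nonneg ‖⟪x, y⟫_ℂ‖, pow_le_one₀ (n := 2) (norm_nonneg x) hx,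
      pow_le_one₀ (n := 2) (norm_nonneg y) hy]
  calc ‖⟪x, z⟫_ℂ - ⟪x, y⟫_ℂ * ⟪y, z⟫_ℂ‖
      = ‖⟪x - ⟪y, x⟫_ℂ • y, z⟫_ℂ‖ := by
        rw [inner_sub_left, inner_smul_left, inner_conj_symm]
    _ ≤ ‖x - ⟪y, x⟫_ℂ • y‖ * ‖z‖ := norm_inner_le_norm _ _
    _ ≤ ‖x - ⟪y, x⟫_ℂ • y‖ := mul_le_of_le_one_right (norm_nonneg _) hz
    _ ≤ _ := hperp

theorem IsPosDefFun.exists_norm_le_one {f : G → ℂ} (hf : IsPosDefFun f) (h1 : ‖f 1‖ ≤ 1) {n : ℕ}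
    (g : Fin n → G) : ∃ v : Fin n → EuclideanSpace ℂ (Fin n),
      (∀ i, ‖v i‖ ≤ 1) ∧ ∀ i j, ⟪v i, v j⟫_ℂ = f ((g i)⁻¹ * g j) := by
  obtain ⟨v, hv⟩ := exists_eq_gram_of_posSemidef (hf n g)
  have hv' : ∀ i j, ⟪v i, v j⟫_ℂ = f ((g i)⁻¹ * g j) :=
    fun i j => (congrFun (congrFun hv i) j).symm
  refine ⟨v, fun i => ?_, hv'⟩
  rw [← sq_le_one_iff₀ (norm_nonneg _)]
  rwa [← inv_mul_cancel (g i), ← hv', inner_self_eq_norm_sq_to_K, norm_pow,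
    RCLike.norm_ofReal, abs_norm] at h1

theorem IsPosDefFun.norm_le_one {f : G → ℂ} (hf : IsPosDefFun f) (h1 : ‖f 1‖ ≤ 1) (g : G) :
    ‖f g‖ ≤ 1 := by
  obtain ⟨v, hn, hv⟩ := hf.exists_norm_le_one h1 ![1, g]
  have hg : ⟪v 0, v 1⟫_ℂ = f g := by simp [hv]
  rw [← hg]
  exact (norm_inner_le_norm _ _).trans (mul_le_one₀ (hn 0) (norm_nonneg _) (hn 1))

theorem IsPosDefFun.norm_map_mul_sub_le {f : G → ℂ} (hf : IsPosDefFun f) (h1 : ‖f 1‖ ≤ 1)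
    (g h : G) : ‖f (g * h) - f g * f h‖ ≤ √(1 - ‖f g‖ ^ 2) := by
  obtain ⟨v, hn, hv⟩ := hf.exists_norm_le_one h1 ![1, g, g * h]
  have hg : ⟪v 0, v 1⟫_ℂ = f g := by simp [hv]
  have hh : ⟪v 1, v 2⟫_ℂ = f h := by simp [hv]
  have hgh : ⟪v 0, v 2⟫_ℂ = f (g * h) := by simp [hv]
  rw [← hg, ← hh, ← hgh]
  exact norm_inner_sub_mul_inner_le (hn 0) (hn 1) (hn 2)

section Limit

variable {ι : Type*} {l : Filter ι} {f : ι → G → ℂ} {g h : ι → G}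

theorem IsPosDefFun.tendsto_map_mul_sub (hf : ∀ i, IsPosDefFun (f i)) (h1 : ∀ i, ‖f i 1‖ ≤ 1)
    (hg : Tendsto (fun i => ‖f i (g i)‖) l (𝓝 1)) :
    Tendsto (fun i => f i (g i * h i) - f i (g i) * f i (h i)) l (𝓝 0) := by
  refine squeeze_zero_norm (fun i => (hf i).norm_map_mul_sub_le (h1 i) (g i) (h i)) ?_
  simpa using ((hg.pow 2).const_sub 1).sqrt

theorem IsPosDefFun.tendsto_norm_map_mul (hf : ∀ i, IsPosDefFun (f i)) (h1 : ∀ i, ‖f i 1‖ ≤ 1)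
    (hg : Tendsto (fun i => ‖f i (g i)‖) l (𝓝 1)) (hh : Tendsto (fun i => ‖f i (h i)‖) l (𝓝 1)) :
    Tendsto (fun i => ‖f i (g i * h i)‖) l (𝓝 1) := by
  have hprod := hg.mul hh
  simp only [← norm_mul, mul_one] at hprod
  have hsub : Tendsto (fun i => ‖f i (g i * h i)‖ - ‖f i (g i) * f i (h i)‖) l (𝓝 0) :=
    squeeze_zero_norm (fun i => abs_norm_sub_norm_le _ _)
      (tendsto_zero_iff_norm_tendsto_zero.1 (tendsto_map_mul_sub hf h1 hg))
  simpa using hsub.add hprod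

theorem IsPosDefFun.tendsto_map_commutator (hf : ∀ i, IsPosDefFun (f i)) (h1 : ∀ i, ‖f i 1‖ ≤ 1)
    (hg : Tendsto (fun i => ‖f i (g i)‖) l (𝓝 1)) (hh : Tendsto (fun i => ‖f i (h i)‖) l (𝓝 1)) :
    Tendsto (fun i => f i ((h i * g i)⁻¹ * (g i * h i))) l (𝓝 1) := by
  set c : ι → G := fun i => (h i * g i)⁻¹ * (g i * h i)
  have hhg := tendsto_norm_map_mul hf h1 hh hg
  have swap : Tendsto (fun i => f i (g i * h i) - f i (h i * g i)) l (𝓝 0) := by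
    simpa [mul_comm] using (tendsto_map_mul_sub hf h1 hg (h := h)).sub
      (tendsto_map_mul_sub hf h1 hh (h := g))
  have factor : Tendsto (fun i => f i (h i * g i) * (f i (c i) - 1)) l (𝓝 0) := by
    refine (sub_zero (0 : ℂ) ▸ swap.sub (tendsto_map_mul_sub hf h1 hhg (h := c))).congr fun i => ?_
    rw [mul_inv_cancel_left]
    ring
  rw [← tendsto_sub_nhds_zero_iff, tendsto_zero_iff_norm_tendsto_zero]
  have hquot := factor.norm.div hhg one_ne_zero
  rw [norm_zero, zero_div] at hquot
  refine hquot.congr' ?_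
  filter_upwards [hhg.eventually_ne one_ne_zero] with i hi
  rw [Pi.div_apply, norm_mul, mul_div_cancel_left₀ _ hi]

end Limit
end PositiveDefinite

section Covariant

variable {G : Type v} [Group G]

theorem System.U_one_apply (S : System.{u, v} G) (x : S.carrier) : S.U 1 x = x := by
  rw [map_one, LinearIsometryEquiv.coe_one, id]

theorem System.U_mul_apply (S : System.{u, v} G) (g k : G) (x : S.carrier) :
    S.U (g * k) x = S.U g (S.U k x) := by
  rw [map_mul]; rfl

/-- The characteristic function `g ↦ ⟨ψ|U(g)|ψ⟩` of a vector. -/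
def charFun (S : System.{u, v} G) (ψ : S.carrier) (g : G) : ℂ :=
  ⟪ψ, S.U g ψ⟫_ℂ

theorem charFun_tensor (S T : System.{u, v} G) (x : S.carrier) (y : T.carrier) (g : G) :
    charFun (S.tensor T) ((x ⊗ₜ[ℂ] y : S.carrier ⊗[ℂ] T.carrier) :
      UniformSpace.Completion (S.carrier ⊗[ℂ] T.carrier)) g = charFun S x g * charFun T y g := by
  change ⟪((x ⊗ₜ[ℂ] y : S.carrier ⊗[ℂ] T.carrier) :
      UniformSpace.Completion (S.carrier ⊗[ℂ] T.carrier)),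
      completionIso (TensorProduct.congrIsometry (S.U g) (T.U g)) (x ⊗ₜ[ℂ] y : _ ⊗[ℂ] _)⟫_ℂ = _
  rw [completionIso_coe, UniformSpace.Completion.inner_coe]
  exact TensorProduct.inner_tmul ℂ x (S.U g x) y (T.U g y)

theorem charFun_powerVec (S : System.{u, v} G) (ψ : S.carrier) (n : ℕ) (g : G) :
    charFun (S.power n) (S.powerVec ψ n) g = charFun S ψ g ^ n := by
  induction n with
  | zero =>
    change ⟪(EuclideanSpace.single PUnit.unit 1 : EuclideanSpace ℂ PUnit.{u + 1}),
      EuclideanSpace.single PUnit.unit 1⟫_ℂ = _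
    simp
  | succ n ih =>
    rw [pow_succ, ← ih]
    exact charFun_tensor (S.power n) S (S.powerVec ψ n) ψ g

theorem norm_charFun_le_one (S : System.{u, v} G) {ψ : S.carrier} (hψ : ‖ψ‖ = 1) (g : G) :
    ‖charFun S ψ g‖ ≤ 1 := by
  simpa [charFun, hψ] using norm_inner_le_norm (𝕜 := ℂ) ψ (S.U g ψ)

variable {S : System.{u, v} G} {T : System.{w, v} G}

/-- The overlap `⟨V(g)Φ| ℰ(|U(g)Ψ⟩⟨Ψ|) |Φ⟩`, which a covariant channel `ℰ` makes a positive definite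
function of `g`. -/
def overlapFun (E : Channel S.carrier T.carrier) (Ψ : S.carrier) (Φ : T.carrier) (g : G) : ℂ :=
  ⟪T.U g Φ, (E.map (ketBra (S.U g Ψ) Ψ) : T.carrier →L[ℂ] T.carrier) Φ⟫_ℂ

theorem overlapFun_one (E : Channel S.carrier T.carrier) (Ψ : S.carrier) (Φ : T.carrier) :
    overlapFun E Ψ Φ 1 = ⟪Φ, (E.map (ketBra Ψ Ψ) : T.carrier →L[ℂ] T.carrier) Φ⟫_ℂ := by
  rw [overlapFun, S.U_one_apply, T.U_one_apply]

theorem IsCovariant.inner_map_ketBra {E : Channel S.carrier T.carrier} (hE : IsCovariant S T E)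
    (Ψ : S.carrier) (Φ : T.carrier) (g k : G) :
    ⟪T.U g Φ, (E.map (ketBra (S.U g Ψ) (S.U k Ψ)) : T.carrier →L[ℂ] T.carrier) (T.U k Φ)⟫_ℂ
      = overlapFun E Ψ Φ (k⁻¹ * g) := by
  have hmap : E.map (ketBra (S.U g Ψ) (S.U k Ψ))
      = conjTC (T.U k) (E.map (ketBra (S.U (k⁻¹ * g) Ψ) Ψ)) := by
    rw [← hE, conjTC_ketBra, ← S.U_mul_apply, mul_inv_cancel_left]
  have hg : T.U g Φ = T.U k (T.U (k⁻¹ * g) Φ) := by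
    rw [← T.U_mul_apply, mul_inv_cancel_left]
  rw [hmap, hg, conjTC, conj_apply, LinearIsometryEquiv.inner_map_map,
    LinearIsometryEquiv.symm_apply_apply, overlapFun]

theorem IsCovariant.isPosDefFun_overlapFun {E : Channel S.carrier T.carrier}
    (hE : IsCovariant S T E) (Ψ : S.carrier) (Φ : T.carrier) :
    IsPosDefFun (overlapFun E Ψ Φ) := by
  intro n g
  have hpos := (E.completelyPositive n _ (blockPositive_ketBra fun i => S.U (g i) Ψ)).posSemidef
    fun i => T.U (g i) Φ
  simp only [hE.inner_map_ketBra] at hpos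
  exact hpos.transpose

theorem IsCovariant.norm_charFun_sub_le {E : Channel S.carrier T.carrier} (hE : IsCovariant S T E)
    {Ψ : S.carrier} (hΨ : ‖Ψ‖ = 1) {Φ : T.carrier} (hΦ : ‖Φ‖ = 1) (g : G) :
    ‖charFun S Ψ g - charFun T Φ g * overlapFun E Ψ Φ g‖
      ≤ 2 * √(1 - (overlapFun E Ψ Φ 1).re) := by
  have hpos := E.completelyPositive 2 _ (blockPositive_ketBra ![S.U g Ψ, Ψ])
  have htr := fun x y => (E.tracePreserving (ketBra x y)).trans (tr_rankOne x y)
  have hbound := hpos.norm_tr_sub_le zero_ne_one (p := T.U g Φ) (q := Φ) (by simp [hΦ]) hΦ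
  have hdiag := hE.inner_map_ketBra Ψ Φ g g
  rw [inv_mul_cancel] at hdiag
  simp only [Matrix.cons_val_zero, Matrix.cons_val_one, htr, hdiag, ← overlapFun_one,
    LinearIsometryEquiv.inner_map_map, inner_self_eq_one_of_norm_eq_one hΨ, one_re, sub_re,
    Real.sqrt_one, mul_one] at hbound
  refine hbound.trans ?_
  rw [two_mul]
  gcongr
  rcases le_total (overlapFun E Ψ Φ 1).re 1 with h1 | h1
  · exact mul_le_of_le_one_left (Real.sqrt_nonneg _) (Real.sqrt_le_one.2 h1)
  · rw [Real.sqrt_eq_zero_of_nonpos (sub_nonpos.2 h1), mul_zero]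

theorem CovariantlyConvertible.exists_isPosDefFun {Ψ : S.carrier} {hΨ : ‖Ψ‖ = 1} {Φ : T.carrier}
    (hΦ : ‖Φ‖ = 1) {σ : DensityOp T.carrier}
    (h : CovariantlyConvertible S T (pureState Ψ hΨ) σ) :
    ∃ f : G → ℂ, IsPosDefFun f ∧ ‖f 1‖ ≤ 1 ∧ ∀ g,
      ‖charFun S Ψ g - charFun T Φ g * f g‖ ≤ 2 * √(1 - fid σ (pureState Φ hΦ) ^ 2) := by
  obtain ⟨E, hE, hEσ⟩ := h
  have hσ : overlapFun E Ψ Φ 1 = ⟪Φ, σ.op Φ⟫_ℂ := by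
    rw [overlapFun_one]
    exact congrArg (fun X : traceClass T.carrier => ⟪Φ, (X : T.carrier →L[ℂ] T.carrier) Φ⟫_ℂ) hEσ
  have hnonneg : 0 ≤ (⟪Φ, σ.op Φ⟫_ℂ).re := (Complex.nonneg_iff.1 (σ.inner_nonneg Φ)).1
  refine ⟨overlapFun E Ψ Φ, hE.isPosDefFun_overlapFun Ψ Φ, ?_, fun g => ?_⟩
  · rw [hσ, ← σ.ofReal_re_inner, norm_real, Real.norm_of_nonneg hnonneg]
    exact σ.re_inner_le_one hΦ
  · rw [fid_pureState, Real.sq_sqrt hnonneg, ← hσ]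
    exact hE.norm_charFun_sub_le hΨ hΦ g

/-- What an asymptotic covariant transformation from `ψ` to `φ` at rate `R` implies for the
characteristic functions: `χ_ψ ^ N` and `χ_φ ^ ⌊N R⌋ * f N` are uniformly close, with `f N` positive
definite. Uniformity in the group element is expressed through sequences. -/
structure IsAsymptoticFactor (S : System.{u, v} G) (T : System.{w, v} G) (ψ : S.carrier)
    (φ : T.carrier) (R : ℝ) (f : ℕ → G → ℂ) : Prop where
  isPosDefFun : ∀ N, IsPosDefFun (f N)
  norm_one_le : ∀ N, ‖f N 1‖ ≤ 1
  tendsto_sub : ∀ g : ℕ → G, Tendsto (fun N : ℕ =>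
    charFun S ψ (g N) ^ N - charFun T φ (g N) ^ ⌊(N : ℝ) * R⌋₊ * f N (g N)) atTop (𝓝 0)

theorem AsymptoticallyConvertible.exists_isAsymptoticFactor {ψ : S.carrier} {hψ : ‖ψ‖ = 1}
    {φ : T.carrier} {hφ : ‖φ‖ = 1} {R : ℝ} (h : AsymptoticallyConvertible S T ψ hψ φ hφ R) :
    ∃ f, IsAsymptoticFactor S T ψ φ R f := by
  obtain ⟨σ, hσ, hfid⟩ := h
  choose f hf h1 hle using fun N => (hσ N).exists_isPosDefFun (T.norm_powerVec hφ _)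
  refine ⟨f, hf, h1, fun g => squeeze_zero_norm
    (a := fun N => 2 * √(1 - fid (σ N) (T.powerState φ hφ ⌊(N : ℝ) * R⌋₊) ^ 2))
    (fun N => ?_) ?_⟩
  · simpa only [charFun_powerVec, System.powerState] using hle N (g N)
  · simpa using ((hfid.pow 2).const_sub 1).sqrt.const_mul 2

end Covariant

section Limits

variable {ι : Type*} {l : Filter ι} {k : ι → ℕ} {c : ι → ℝ} {r : ℝ}

theorem tendsto_one_add_pow_exp {z : ι → ℂ} {t : ℂ} (hz : Tendsto z l (𝓝 0))
    (ht : Tendsto (fun i => (k i : ℂ) * z i) l (𝓝 t)) :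
    Tendsto (fun i => (1 + z i) ^ k i) l (𝓝 (exp t)) := by
  have hone : Tendsto (fun i => 1 + z i) l (𝓝 1) := by simpa using hz.const_add 1
  have hslope : Tendsto (fun i => dslope log 1 (1 + z i)) l (𝓝 1) := by
    have hcont := continuousAt_dslope_same.2 (differentiableAt_log one_mem_slitPlane)
    simpa [Function.comp_def, dslope_same, (hasDerivAt_log one_mem_slitPlane).deriv] using
      hcont.tendsto.comp hone
  have hlog : Tendsto (fun i => (k i : ℂ) * log (1 + z i)) l (𝓝 t) := by
    refine (mul_one t ▸ ht.mul hslope).congr fun i => ?_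
    have h := sub_smul_dslope log 1 (1 + z i)
    rw [add_sub_cancel_left, log_one, sub_zero, smul_eq_mul] at h
    rw [mul_assoc, h]
  refine ((continuous_exp.tendsto t).comp hlog).congr' ?_
  filter_upwards [hone.eventually_ne one_ne_zero] with i hi
  rw [Function.comp_apply, exp_nat_mul, exp_log hi]

variable {H : Type*} [NormedAddCommGroup H] [InnerProductSpace ℂ H] {ψ : H}

/-- The squared norm of the component of `w` orthogonal to the unit vector `ψ`; for `w = L ψ` with
`L` self-adjoint it is the variance of `L` in the state `ψ`. -/
def orthNormSq (ψ w : H) : ℝ :=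
  ‖w‖ ^ 2 - ‖⟪ψ, w⟫_ℂ‖ ^ 2

theorem continuous_orthNormSq (ψ : H) : Continuous (orthNormSq ψ) := by
  unfold orthNormSq
  fun_prop

theorem orthNormSq_smul (ψ : H) (a : ℂ) (w : H) :
    orthNormSq ψ (a • w) = ‖a‖ ^ 2 * orthNormSq ψ w := by
  rw [orthNormSq, orthNormSq, norm_smul, inner_smul_right, norm_mul]
  ring

theorem orthNormSq_sub_self (hψ : ‖ψ‖ = 1) (u : H) : orthNormSq ψ (u - ψ) = orthNormSq ψ u := by
  have h := norm_sub_sq (𝕜 := ℂ) ⟪ψ, u⟫_ℂ 1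
  simp only [RCLike.inner_apply, one_mul, norm_one, one_pow, conj_re,
    RCLike.re_eq_complex_re] at h
  rw [orthNormSq, orthNormSq, norm_sub_sq (𝕜 := ℂ), inner_sub_right,
    inner_self_eq_one_of_norm_eq_one hψ, h, hψ, inner_re_symm, RCLike.re_eq_complex_re]
  ring

theorem tendsto_zero_of_tendsto_smul {V : Type*} [NormedAddCommGroup V] [NormedSpace ℝ V]
    {x : ι → V} {w : V} (hc : Tendsto c l atTop) (h : Tendsto (fun i => c i • x i) l (𝓝 w)) :
    Tendsto x l (𝓝 0) := by
  have hinv := (tendsto_inv_atTop_zero.comp hc).smul h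
  rw [zero_smul] at hinv
  refine hinv.congr' ?_
  filter_upwards [hc.eventually_ne_atTop 0] with i hi
  rw [Function.comp_apply, inv_smul_smul₀ hi]

variable {u : ι → H} {w : H}

theorem tendsto_inner_pow_exp (hψ : ‖ψ‖ = 1) (hc : Tendsto c l atTop)
    (hk : Tendsto (fun i => k i / c i) l (𝓝 r)) (h : Tendsto (fun i => c i • (u i - ψ)) l (𝓝 w)) :
    Tendsto (fun i => ⟪ψ, u i⟫_ℂ ^ k i) l (𝓝 (exp (r * ⟪ψ, w⟫_ℂ))) := by
  have hsub : ∀ i, ⟪ψ, u i⟫_ℂ = 1 + ⟪ψ, u i - ψ⟫_ℂ := fun i => by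
    rw [inner_sub_right, inner_self_eq_one_of_norm_eq_one hψ, add_sub_cancel]
  simp only [hsub]
  refine tendsto_one_add_pow_exp ?_ ?_
  · rw [← inner_zero_right (𝕜 := ℂ) ψ]
    exact tendsto_const_nhds.inner (tendsto_zero_of_tendsto_smul hc h)
  · refine (hk.ofReal.mul ((tendsto_const_nhds (x := ψ)).inner (𝕜 := ℂ) h)).congr' ?_
    filter_upwards [hc.eventually_ne_atTop 0] with i hi
    rw [← coe_smul (c i), inner_smul_right, ← mul_assoc, ← ofReal_mul, div_mul_cancel₀ _ hi,
      ofReal_natCast]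

theorem tendsto_norm_inner_pow_exp (hψ : ‖ψ‖ = 1) (hu : ∀ i, ‖u i‖ = 1) (hc : Tendsto c l atTop)
    (hk : Tendsto (fun i => k i / c i ^ 2) l (𝓝 r))
    (h : Tendsto (fun i => c i • (u i - ψ)) l (𝓝 w)) :
    Tendsto (fun i => ‖⟪ψ, u i⟫_ℂ‖ ^ k i) l (𝓝 (Real.exp (-(r * orthNormSq ψ w) / 2))) := by
  have hvar : Tendsto (fun i => c i ^ 2 * orthNormSq ψ (u i)) l (𝓝 (orthNormSq ψ w)) := by
    refine ((continuous_orthNormSq ψ).tendsto w |>.comp h).congr fun i => ?_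
    rw [Function.comp_apply, ← coe_smul (c i), orthNormSq_smul, norm_real, Real.norm_eq_abs, sq_abs,
      orthNormSq_sub_self hψ]
  have hzero : Tendsto (fun i => orthNormSq ψ (u i)) l (𝓝 0) :=
    tendsto_zero_of_tendsto_smul ((tendsto_pow_atTop two_ne_zero).comp hc) hvar
  have hmul : Tendsto (fun i => k i * orthNormSq ψ (u i)) l (𝓝 (r * orthNormSq ψ w)) := by
    refine (hk.mul hvar).congr' ?_
    filter_upwards [hc.eventually_ne_atTop 0] with i hi
    rw [← mul_assoc, div_mul_cancel₀ _ (pow_ne_zero 2 hi)]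
  have hsq : Tendsto (fun i => (‖⟪ψ, u i⟫_ℂ‖ ^ k i) ^ 2) l
      (𝓝 (Real.exp (-(r * orthNormSq ψ w)))) := by
    have hpow := tendsto_one_add_pow_exp (k := k) (z := fun i => ((-orthNormSq ψ (u i) : ℝ) : ℂ))
      (t := ((-(r * orthNormSq ψ w) : ℝ) : ℂ)) (by simpa using hzero.neg.ofReal)
      (by simpa using hmul.neg.ofReal)
    rw [← ofReal_exp] at hpow
    refine (tendsto_ofReal_iff.1 (hpow.congr fun i => ?_))
    rw [orthNormSq, hu]
    push_cast
    ring
  rw [Real.exp_half]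
  simpa only [Real.sqrt_sq (pow_nonneg (norm_nonneg _) _)] using hsq.sqrt

end Limits

section Consequences

theorem rankOne_self_eq_rankOne_self_iff {H : Type*} [NormedAddCommGroup H]
    [InnerProductSpace ℂ H] {x y : H} (hx : ‖x‖ = 1) (hy : ‖y‖ = 1) :
    rankOne ℂ x x = rankOne ℂ y y ↔ ‖⟪x, y⟫_ℂ‖ = 1 := by
  constructor
  · intro h
    have hy' : ⟪x, y⟫_ℂ • x = y := by
      have := DFunLike.congr_fun h y
      rwa [rankOne_apply, rankOne_apply, inner_self_eq_one_of_norm_eq_one hy, one_smul] at this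
    simpa [norm_smul, hx, hy] using congrArg norm hy'
  · intro h
    have hne : ∀ {z : H}, ‖z‖ = 1 → z ≠ 0 := fun hz => norm_ne_zero_iff.1 (hz ▸ one_ne_zero)
    obtain ⟨a, -, rfl⟩ :=
      (norm_inner_eq_norm_iff (𝕜 := ℂ) (hne hx) (hne hy)).1 (by simp [h, hx, hy])
    have ha : a * starRingEnd ℂ a = 1 := by
      rw [norm_smul, hx, mul_one] at hy
      rw [mul_conj, normSq_eq_norm_sq, hy, one_pow, ofReal_one]
    ext z
    rw [rankOne_apply, rankOne_apply, inner_smul_left, smul_smul, mul_right_comm, mul_comm _ a, ha,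
      one_mul]

variable {G : Type v} [Group G] {S : System.{u, v} G} {T : System.{w, v} G} {ψ : S.carrier}
  {φ : T.carrier} {R : ℝ}

theorem mem_sym_pureState_iff (hψ : ‖ψ‖ = 1) {g : G} :
    g ∈ sym S (pureState ψ hψ) ↔ ‖charFun S ψ g‖ = 1 := by
  have hconj : conj (S.U g) (rankOne ℂ ψ ψ) = rankOne ℂ (S.U g ψ) (S.U g ψ) :=
    congrArg Subtype.val (conjTC_ketBra (S.U g) ψ ψ)
  rw [charFun, norm_inner_symm,
    ← rankOne_self_eq_rankOne_self_iff (by rw [LinearIsometryEquiv.norm_map, hψ]) hψ, ← hconj]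
  rfl

theorem tendsto_natFloor_mul_div (hR : 0 ≤ R) :
    Tendsto (fun N : ℕ => (⌊(N : ℝ) * R⌋₊ : ℝ) / N) atTop (𝓝 R) := by
  simpa only [mul_comm, Function.comp_def] using
    (tendsto_nat_floor_mul_div_atTop hR).comp (tendsto_natCast_atTop_atTop (R := ℝ))

theorem tendsto_natCast_div_natCast :
    Tendsto (fun N : ℕ => (N : ℝ) / N) atTop (𝓝 1) := by
  refine tendsto_const_nhds.congr' ?_
  filter_upwards [eventually_ne_atTop 0] with N hN
  rw [div_self (Nat.cast_ne_zero.2 hN)]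

theorem tendsto_sqrt_natCast_atTop : Tendsto (fun N : ℕ => √(N : ℝ)) atTop atTop :=
  Real.tendsto_sqrt_atTop.comp tendsto_natCast_atTop_atTop

theorem tendsto_norm_charFun_pow {g : ℕ → G} {w : S.carrier} {k : ℕ → ℕ} {r : ℝ} (hψ : ‖ψ‖ = 1)
    (hk : Tendsto (fun N => (k N : ℝ) / N) atTop (𝓝 r))
    (hw : Tendsto (fun N : ℕ => √(N : ℝ) • (S.U (g N) ψ - ψ)) atTop (𝓝 w)) :
    Tendsto (fun N => ‖charFun S ψ (g N)‖ ^ k N) atTop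
      (𝓝 (Real.exp (-(r * orthNormSq ψ w) / 2))) :=
  tendsto_norm_inner_pow_exp hψ (fun N => by rw [LinearIsometryEquiv.norm_map, hψ])
    tendsto_sqrt_natCast_atTop (by simpa only [Real.sq_sqrt (Nat.cast_nonneg _)] using hk) hw

namespace IsAsymptoticFactor

variable {f : ℕ → G → ℂ} {g k : ℕ → G} {w d : S.carrier} {w' d' : T.carrier}

theorem tendsto_norm_sub (hf : IsAsymptoticFactor S T ψ φ R f) (g : ℕ → G) :
    Tendsto (fun N : ℕ => ‖charFun S ψ (g N)‖ ^ N
      - ‖charFun T φ (g N)‖ ^ ⌊(N : ℝ) * R⌋₊ * ‖f N (g N)‖) atTop (𝓝 0) := by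
  refine squeeze_zero_norm (fun N => ?_) (tendsto_zero_iff_norm_tendsto_zero.1 (hf.tendsto_sub g))
  rw [← norm_pow, ← norm_pow, ← norm_mul]
  exact abs_norm_sub_norm_le _ _

theorem norm_charFun_eq_one (hf : IsAsymptoticFactor S T ψ φ R f) (hφ : ‖φ‖ = 1) (hR : 0 < R)
    {g : G} (hg : ‖charFun S ψ g‖ = 1) : ‖charFun T φ g‖ = 1 := by
  refine (norm_charFun_le_one T hφ g).antisymm ?_
  have hlim : Tendsto (fun N : ℕ => ‖charFun T φ g‖ ^ ⌊(N : ℝ) * R⌋₊ * ‖f N g‖) atTop (𝓝 1) := by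
    simpa [hg] using (hf.tendsto_norm_sub fun _ => g).const_sub 1
  have hfloor : Tendsto (fun N : ℕ => ⌊(N : ℝ) * R⌋₊) atTop atTop :=
    tendsto_nat_floor_atTop.comp (tendsto_natCast_atTop_atTop.atTop_mul_const hR)
  refine le_of_tendsto hlim ?_
  filter_upwards [hfloor.eventually_ne_atTop 0] with N hN
  exact (mul_le_of_le_one_right (by positivity)
    ((hf.isPosDefFun N).norm_le_one (hf.norm_one_le N) g)).trans
    (pow_le_of_le_one (norm_nonneg _) (norm_charFun_le_one T hφ g) hN)

theorem mul_orthNormSq_le (hf : IsAsymptoticFactor S T ψ φ R f) (hψ : ‖ψ‖ = 1) (hφ : ‖φ‖ = 1)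
    (hR : 0 ≤ R) (hw : Tendsto (fun N : ℕ => √(N : ℝ) • (S.U (g N) ψ - ψ)) atTop (𝓝 w))
    (hw' : Tendsto (fun N : ℕ => √(N : ℝ) • (T.U (g N) φ - φ)) atTop (𝓝 w')) :
    R * orthNormSq φ w' ≤ orthNormSq ψ w := by
  have hleft := (tendsto_norm_charFun_pow hψ tendsto_natCast_div_natCast hw).sub
    (hf.tendsto_norm_sub g)
  have hright := tendsto_norm_charFun_pow hφ (tendsto_natFloor_mul_div hR) hw'
  have hle := le_of_tendsto_of_tendsto' hleft hright fun N => by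
    rw [sub_sub_cancel]
    exact mul_le_of_le_one_right (by positivity)
      ((hf.isPosDefFun N).norm_le_one (hf.norm_one_le N) (g N))
  rw [sub_zero, Real.exp_le_exp] at hle
  linarith

theorem tendsto_norm_one (hf : IsAsymptoticFactor S T ψ φ R f) (hψ : ‖ψ‖ = 1) (hφ : ‖φ‖ = 1)
    (hR : 0 ≤ R) (hw : Tendsto (fun N : ℕ => √(N : ℝ) • (S.U (g N) ψ - ψ)) atTop (𝓝 w))
    (hw' : Tendsto (fun N : ℕ => √(N : ℝ) • (T.U (g N) φ - φ)) atTop (𝓝 w'))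
    (hvar : orthNormSq ψ w = R * orthNormSq φ w') :
    Tendsto (fun N => ‖f N (g N)‖) atTop (𝓝 1) := by
  have hψpow := (tendsto_norm_charFun_pow hψ tendsto_natCast_div_natCast hw).sub
    (hf.tendsto_norm_sub g)
  have hφpow := tendsto_norm_charFun_pow hφ (tendsto_natFloor_mul_div hR) hw'
  have hne : Real.exp (-(R * orthNormSq φ w') / 2) ≠ 0 := (Real.exp_pos _).ne'
  have hquot := hψpow.div hφpow hne
  rw [one_mul, hvar, sub_zero, div_self hne] at hquot
  refine hquot.congr' ?_
  filter_upwards [hφpow.eventually_ne hne] with N hN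
  rw [Pi.div_apply, sub_sub_cancel, mul_div_cancel_left₀ _ hN]

theorem exp_inner_eq (hf : IsAsymptoticFactor S T ψ φ R f) (hψ : ‖ψ‖ = 1) (hφ : ‖φ‖ = 1)
    (hR : 0 ≤ R) (hg : Tendsto (fun N => ‖f N (g N)‖) atTop (𝓝 1))
    (hk : Tendsto (fun N => ‖f N (k N)‖) atTop (𝓝 1))
    (hd : Tendsto (fun N : ℕ => (N : ℝ) • (S.U ((k N * g N)⁻¹ * (g N * k N)) ψ - ψ)) atTop (𝓝 d))
    (hd' : Tendsto (fun N : ℕ => (N : ℝ) • (T.U ((k N * g N)⁻¹ * (g N * k N)) φ - φ)) atTop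
      (𝓝 d')) :
    exp ⟪ψ, d⟫_ℂ = exp (R * ⟪φ, d'⟫_ℂ) := by
  have hψpow := tendsto_inner_pow_exp hψ tendsto_natCast_atTop_atTop tendsto_natCast_div_natCast hd
  have hφpow := tendsto_inner_pow_exp hφ tendsto_natCast_atTop_atTop
    (tendsto_natFloor_mul_div hR) hd'
  have hfactor := IsPosDefFun.tendsto_map_commutator hf.isPosDefFun hf.norm_one_le hg hk
  have h := tendsto_nhds_unique (hf.tendsto_sub fun N => (k N * g N)⁻¹ * (g N * k N))
    (hψpow.sub (hφpow.mul hfactor))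
  simpa using sub_eq_zero.1 h.symm

end IsAsymptoticFactor

theorem AsymptoticallyConvertible.sym_subset {hψ : ‖ψ‖ = 1} {hφ : ‖φ‖ = 1}
    (h : AsymptoticallyConvertible S T ψ hψ φ hφ R) (hR : 0 < R) :
    sym S (pureState ψ hψ) ⊆ sym T (pureState φ hφ) := by
  intro g hg
  obtain ⟨f, hf⟩ := h.exists_isAsymptoticFactor
  rw [mem_sym_pureState_iff] at hg ⊢
  exact hf.norm_charFun_eq_one hφ hR hg

theorem ReversiblyConvertible.sym_eq {hψ : ‖ψ‖ = 1} {hφ : ‖φ‖ = 1}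
    (h : ReversiblyConvertible S T ψ hψ φ hφ R) (hR : 0 < R) :
    sym S (pureState ψ hψ) = sym T (pureState φ hφ) :=
  (h.1.sym_subset hR).antisymm (h.2.sym_subset (inv_pos.2 hR))

end Consequences

section LocalGroupLaw

open Asymptotics

variable {E : Type*} [NormedAddCommGroup E] [NormedSpace ℝ E] {m : E × E → E} {x₀ : E}

/-- A twice continuously differentiable operation near `(x₀, x₀)` for which `x₀` is a two-sided
unit, such as the multiplication of a Lie group read in a chart. -/
structure IsLocalUnitalLaw (m : E × E → E) (x₀ : E) : Prop where
  contDiffAt : ContDiffAt ℝ 2 m (x₀, x₀)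
  right_unit : ∀ᶠ x in 𝓝 x₀, m (x, x₀) = x
  left_unit : ∀ᶠ x in 𝓝 x₀, m (x₀, x) = x

/-- The mixed second derivative `∂₁ ∂₂ m` at `(x₀, x₀)`, the bilinear part of a local group law. -/
def mixedFDeriv (m : E × E → E) (x₀ : E) : E →L[ℝ] E →L[ℝ] E :=
  (ContinuousLinearMap.compL ℝ E (E × E) E).flip (.inr ℝ E E) ∘L
    fderiv ℝ (fderiv ℝ m) (x₀, x₀) ∘L .inl ℝ E E

namespace IsLocalUnitalLaw

theorem eventually_differentiableAt (hm : IsLocalUnitalLaw m x₀) :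
    ∀ᶠ q in 𝓝 (x₀, x₀), DifferentiableAt ℝ m q :=
  (hm.contDiffAt.eventually (by simp)).mono fun _ hq => hq.differentiableAt two_ne_zero

theorem hasFDerivAt_fderiv (hm : IsLocalUnitalLaw m x₀) :
    HasFDerivAt (fderiv ℝ m) (fderiv ℝ (fderiv ℝ m) (x₀, x₀)) (x₀, x₀) :=
  ((hm.contDiffAt.fderiv_right (m := 1) (by norm_num)).differentiableAt one_ne_zero).hasFDerivAt

theorem hasFDerivAt_fderiv_inl (hm : IsLocalUnitalLaw m x₀) (w : E) :
    HasFDerivAt (fun x => fderiv ℝ m (x, x₀) (0, w)) ((mixedFDeriv m x₀).flip w) x₀ :=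
  (ContinuousLinearMap.apply ℝ E ((0 : E), w)).hasFDerivAt.comp x₀
    (HasFDerivAt.comp x₀ (f := fun x => (x, x₀)) hm.hasFDerivAt_fderiv
      (hasFDerivAt_prodMk_left x₀ x₀))

theorem eventually_fderiv_inr (hm : IsLocalUnitalLaw m x₀) :
    ∀ᶠ y in 𝓝 x₀, ∀ w, fderiv ℝ m (x₀, y) (0, w) = w := by
  have hinr : Tendsto (fun y => (x₀, y)) (𝓝 x₀) (𝓝 (x₀, x₀)) :=
    (Continuous.prodMk_right x₀).tendsto x₀
  filter_upwards [hinr.eventually hm.eventually_differentiableAt, hm.left_unit.eventually_nhds]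
    with y hdiff hunit w
  have hpartial : HasFDerivAt (fun z => m (x₀, z)) (fderiv ℝ m (x₀, y) ∘L .inr ℝ E E) y :=
    hdiff.hasFDerivAt.comp y (hasFDerivAt_prodMk_right x₀ y)
  exact DFunLike.congr_fun (hpartial.unique ((hasFDerivAt_id y).congr_of_eventuallyEq hunit)) w

theorem lieBracket_fderiv_inr (hm : IsLocalUnitalLaw m x₀) (v w : E) :
    VectorField.lieBracket ℝ (fun x => fderiv ℝ m (x, x₀) (0, v))
        (fun x => fderiv ℝ m (x, x₀) (0, w)) x₀
      = mixedFDeriv m x₀ v w - mixedFDeriv m x₀ w v := by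
  have hunit := hm.eventually_fderiv_inr.self_of_nhds
  rw [VectorField.lieBracket, (hm.hasFDerivAt_fderiv_inl v).fderiv,
    (hm.hasFDerivAt_fderiv_inl w).fderiv, hunit, hunit]
  rfl

theorem fderiv_fderiv_inr_inr (hm : IsLocalUnitalLaw m x₀) (v w : E) :
    fderiv ℝ (fderiv ℝ m) (x₀, x₀) (0, v) (0, w) = 0 := by
  have hpartial : HasFDerivAt (fun y => fderiv ℝ m (x₀, y) (0, w)) _ x₀ :=
    (ContinuousLinearMap.apply ℝ E ((0 : E), w)).hasFDerivAt.comp x₀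
      (hm.hasFDerivAt_fderiv.comp x₀ (hasFDerivAt_prodMk_right x₀ x₀))
  have hconst : HasFDerivAt (fun y => fderiv ℝ m (x₀, y) (0, w)) (0 : E →L[ℝ] E) x₀ :=
    (hasFDerivAt_const w x₀).congr_of_eventuallyEq
      (hm.eventually_fderiv_inr.mono fun _ hy => hy w)
  exact DFunLike.congr_fun (hpartial.unique hconst) v

theorem fderiv_remainder_comp_inr (hm : IsLocalUnitalLaw m x₀) (x y : E) :
    (fderiv ℝ m (x, y) - fderiv ℝ m (x₀, x₀)
        - fderiv ℝ (fderiv ℝ m) (x₀, x₀) ((x, y) - (x₀, x₀))) ∘L .inr ℝ E E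
      = fderiv ℝ m (x, y) ∘L .inr ℝ E E - .id ℝ E - mixedFDeriv m x₀ (x - x₀) := by
  ext w
  have hsplit : (x, y) - (x₀, x₀) = (x - x₀, 0) + (0, y - x₀) := by simp
  have hinr : fderiv ℝ m (x₀, x₀) (0, w) = w := hm.eventually_fderiv_inr.self_of_nhds w
  change fderiv ℝ m (x, y) (0, w) - fderiv ℝ m (x₀, x₀) (0, w)
    - fderiv ℝ (fderiv ℝ m) (x₀, x₀) ((x, y) - (x₀, x₀)) (0, w) = _
  rw [hsplit, map_add, add_apply, hinr, hm.fderiv_fderiv_inr_inr, add_zero]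
  rfl

theorem norm_sub_sub_mixedFDeriv_le (hm : IsLocalUnitalLaw m x₀) {x y : E} {C : ℝ}
    (hdiff : ∀ z ∈ Metric.closedBall x₀ ‖y - x₀‖, DifferentiableAt ℝ m (x, z))
    (hC : ∀ z ∈ Metric.closedBall x₀ ‖y - x₀‖, ‖fderiv ℝ m (x, z) - fderiv ℝ m (x₀, x₀)
      - fderiv ℝ (fderiv ℝ m) (x₀, x₀) ((x, z) - (x₀, x₀))‖ ≤ C) :
    ‖m (x, y) - m (x, x₀) - (y - x₀) - mixedFDeriv m x₀ (x - x₀) (y - x₀)‖ ≤ C * ‖y - x₀‖ := by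
  set B := Metric.closedBall x₀ ‖y - x₀‖
  have hderiv : ∀ z ∈ B, HasFDerivWithinAt
      (fun z => m (x, z) - z - mixedFDeriv m x₀ (x - x₀) z)
      ((fderiv ℝ m (x, z) - fderiv ℝ m (x₀, x₀)
        - fderiv ℝ (fderiv ℝ m) (x₀, x₀) ((x, z) - (x₀, x₀))) ∘L .inr ℝ E E) B z := by
    intro z hz
    have hpartial := (hdiff z hz).hasFDerivAt.comp z (hasFDerivAt_prodMk_right x z)
    rw [hm.fderiv_remainder_comp_inr]
    exact ((hpartial.sub (hasFDerivAt_id z)).sub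
      (mixedFDeriv m x₀ (x - x₀)).hasFDerivAt).hasFDerivWithinAt
  have hmvt := (convex_closedBall x₀ ‖y - x₀‖).norm_image_sub_le_of_norm_hasFDerivWithin_le hderiv
    (fun z hz => (ContinuousLinearMap.opNorm_comp_le _ _).trans <| (mul_le_of_le_one_right
      (norm_nonneg _) (ContinuousLinearMap.norm_inr_le_one ℝ E E)).trans (hC z hz))
    (Metric.mem_closedBall_self (norm_nonneg _)) (mem_closedBall_iff_norm.2 le_rfl)
  convert hmvt using 2
  rw [map_sub _ y]
  abel

theorem isLittleO_sub_mixedFDeriv (hm : IsLocalUnitalLaw m x₀) :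
    (fun p : E × E => m p - p.1 - p.2 + x₀ - mixedFDeriv m x₀ (p.1 - x₀) (p.2 - x₀))
      =o[𝓝 (x₀, x₀)] fun p => ‖p - (x₀, x₀)‖ ^ 2 := by
  set q : E × E := (x₀, x₀)
  rw [isLittleO_iff]
  intro ε hε
  obtain ⟨r, hr, hball⟩ := Metric.eventually_nhds_iff_ball.1
    ((hm.hasFDerivAt_fderiv.isLittleO.def hε).and hm.eventually_differentiableAt)
  have hfst : Tendsto Prod.fst (𝓝 q) (𝓝 x₀) := continuous_fst.tendsto q
  filter_upwards [Metric.ball_mem_nhds q hr, hfst.eventually hm.right_unit] with p hp hunit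
  have hnorm : ∀ y ∈ Metric.closedBall x₀ ‖p.2 - x₀‖, ‖(p.1, y) - q‖ ≤ ‖p - q‖ := fun y hy =>
    max_le_max le_rfl (mem_closedBall_iff_norm.1 hy)
  have hmem : ∀ y ∈ Metric.closedBall x₀ ‖p.2 - x₀‖, (p.1, y) ∈ Metric.ball q r := fun y hy =>
    mem_ball_iff_norm.2 ((hnorm y hy).trans_lt (mem_ball_iff_norm.1 hp))
  calc _ = ‖m p - m (p.1, x₀) - (p.2 - x₀) - mixedFDeriv m x₀ (p.1 - x₀) (p.2 - x₀)‖ := by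
        rw [hunit]
        congr 1
        abel
    _ ≤ ε * ‖p - q‖ * ‖p.2 - x₀‖ := hm.norm_sub_sub_mixedFDeriv_le
        (fun y hy => (hball _ (hmem y hy)).2) fun y hy =>
          (hball _ (hmem y hy)).1.trans (by gcongr; exact hnorm y hy)
    _ ≤ ε * ‖p - q‖ * ‖p - q‖ := by gcongr; exact norm_snd_le (p - q)
    _ = ε * ‖‖p - q‖ ^ 2‖ := by rw [norm_pow, norm_norm, sq, mul_assoc]

variable {ι : Type*} {l : Filter ι} {c : ι → ℝ} {x y z : ι → E} {v w : E}

theorem tendsto_sq_smul_sub (hm : IsLocalUnitalLaw m x₀) (hc : Tendsto c l atTop)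
    (hx : Tendsto (fun i => c i • (x i - x₀)) l (𝓝 v))
    (hy : Tendsto (fun i => c i • (y i - x₀)) l (𝓝 w)) :
    Tendsto (fun i => c i ^ 2 • (m (x i, y i) - x i - y i + x₀)) l
      (𝓝 (mixedFDeriv m x₀ v w)) := by
  have hxy : Tendsto (fun i => (x i, y i)) l (𝓝 (x₀, x₀)) :=
    (tendsto_sub_nhds_zero_iff.1 (tendsto_zero_of_tendsto_smul hc hx)).prodMk_nhds
      (tendsto_sub_nhds_zero_iff.1 (tendsto_zero_of_tendsto_smul hc hy))
  have hscaled : (fun i => c i ^ 2 * ‖(x i, y i) - (x₀, x₀)‖ ^ 2) =O[l] fun _ => (1 : ℝ) := by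
    refine (((hx.prodMk_nhds hy).norm.pow 2).isBigO_one ℝ).congr_left fun i => ?_
    rw [← Prod.smul_mk, ← Prod.mk_sub_mk, norm_smul, mul_pow, Real.norm_eq_abs, sq_abs]
  have hrem := ((isBigO_refl (fun i => c i ^ 2) l).smul_isLittleO
    (hm.isLittleO_sub_mixedFDeriv.comp_tendsto hxy)).trans_isBigO hscaled
  have hlim := ((isLittleO_one_iff ℝ).1 hrem).add
    (((mixedFDeriv m x₀).continuous₂.tendsto (v, w)).comp (hx.prodMk_nhds hy))
  rw [zero_add] at hlim
  refine hlim.congr fun i => ?_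
  have hbilin : mixedFDeriv m x₀ (c i • (x i - x₀)) (c i • (y i - x₀))
      = c i ^ 2 • mixedFDeriv m x₀ (x i - x₀) (y i - x₀) := by
    rw [map_smul, map_smul, smul_apply, smul_smul, sq]
  simp only [Function.comp_apply, Function.uncurry_apply_pair, hbilin, ← smul_add, sub_add_cancel]

theorem isEquivalent_sub_left (hm : IsLocalUnitalLaw m x₀) (hx : Tendsto x l (𝓝 x₀))
    (hz : Tendsto z l (𝓝 x₀)) :
    (fun i => m (x i, z i) - x i) ~[l] fun i => z i - x₀ := by
  have hlim : Tendsto (fun i => ((x i, z i), (x i, x₀))) l (𝓝 ((x₀, x₀), (x₀, x₀))) :=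
    (hx.prodMk_nhds hz).prodMk_nhds (hx.prodMk_nhds tendsto_const_nhds)
  have hstrict := ((hm.contDiffAt.hasStrictFDerivAt two_ne_zero).isLittleO).comp_tendsto hlim
  refine (hstrict.congr' ?_ EventuallyEq.rfl).trans_isBigO ?_
  · filter_upwards [hx.eventually hm.right_unit] with i hi
    rw [Function.comp_apply, hi, Prod.mk_sub_mk, sub_self, hm.eventually_fderiv_inr.self_of_nhds]
    rfl
  · refine IsBigO.of_bound 1 (Eventually.of_forall fun i => ?_)
    simp

theorem tendsto_sq_smul_commutator (hm : IsLocalUnitalLaw m x₀) (hc : Tendsto c l atTop)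
    (hx : Tendsto (fun i => c i • (x i - x₀)) l (𝓝 v))
    (hy : Tendsto (fun i => c i • (y i - x₀)) l (𝓝 w)) (hz : Tendsto z l (𝓝 x₀))
    (hxyz : ∀ᶠ i in l, m (m (y i, x i), z i) = m (x i, y i)) :
    Tendsto (fun i => c i ^ 2 • (z i - x₀)) l
      (𝓝 (mixedFDeriv m x₀ v w - mixedFDeriv m x₀ w v)) := by
  have hyx : Tendsto (fun i => m (y i, x i)) l (𝓝 x₀) := by
    have := hm.contDiffAt.continuousAt.tendsto.comp
      ((tendsto_sub_nhds_zero_iff.1 (tendsto_zero_of_tendsto_smul hc hy)).prodMk_nhds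
        (tendsto_sub_nhds_zero_iff.1 (tendsto_zero_of_tendsto_smul hc hx)))
    rwa [hm.right_unit.self_of_nhds] at this
  have hswap : Tendsto (fun i => c i ^ 2 • (m (x i, y i) - m (y i, x i))) l
      (𝓝 (mixedFDeriv m x₀ v w - mixedFDeriv m x₀ w v)) := by
    refine ((hm.tendsto_sq_smul_sub hc hx hy).sub (hm.tendsto_sq_smul_sub hc hy hx)).congr
      fun i => ?_
    rw [← smul_sub]
    congr 1
    abel
  have hequiv : (fun i => m (x i, y i) - m (y i, x i)) ~[l] fun i => z i - x₀ :=
    (hm.isEquivalent_sub_left hyx hz).congr_left (hxyz.mono fun i hi => by simp only [hi])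
  exact (IsEquivalent.refl.smul hequiv).tendsto_nhds hswap

end IsLocalUnitalLaw

end LocalGroupLaw

section LieGroup

variable {E : Type*} [NormedAddCommGroup E] [NormedSpace ℝ E]
  {G : Type*} [Group G] [TopologicalSpace G] [ChartedSpace E G]

variable (E G) in
/-- The group law in the chart at the identity. -/
def chartMul (p : E × E) : E :=
  extChartAt 𝓘(ℝ, E) (1 : G) ((extChartAt 𝓘(ℝ, E) (1 : G)).symm p.1
    * (extChartAt 𝓘(ℝ, E) (1 : G)).symm p.2)

variable (E G) in
/-- The identity in the chart at the identity. -/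
def chartOne : E :=
  extChartAt 𝓘(ℝ, E) (1 : G) 1

theorem extChartAt_symm_chartOne : (extChartAt 𝓘(ℝ, E) (1 : G)).symm (chartOne E G) = 1 :=
  extChartAt_to_inv (1 : G)

theorem extChartAt_target_mem_nhds_chartOne :
    (extChartAt 𝓘(ℝ, E) (1 : G)).target ∈ 𝓝 (chartOne E G) :=
  extChartAt_target_mem_nhds (1 : G)

/-- The family `g` of group elements approaches the identity along `X` at speed `1 / c`: it tends
to `1`, and in the chart at `1` its displacements multiplied by `c` tend to `X`. -/
structure HasVelocity {ι : Type*} (l : Filter ι) (c : ι → ℝ) (g : ι → G)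
    (X : GroupLieAlgebra 𝓘(ℝ, E) G) : Prop where
  tendsto_one : Tendsto g l (𝓝 1)
  tendsto_smul : Tendsto (fun i => c i • (extChartAt 𝓘(ℝ, E) (1 : G) (g i) - chartOne E G)) l
    (𝓝 (X : E))

theorem exists_hasVelocity {ι : Type*} {l : Filter ι} {c : ι → ℝ} (hc : Tendsto c l atTop)
    (X : GroupLieAlgebra 𝓘(ℝ, E) G) : ∃ g : ι → G, HasVelocity l c g X := by
  let v : E := X
  let x : ι → E := fun i => chartOne E G + (c i)⁻¹ • v
  have hx : Tendsto x l (𝓝 (chartOne E G)) := by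
    simpa only [Pi.inv_apply, zero_smul, add_zero, x] using
      (hc.inv_tendsto_atTop.smul_const v).const_add (chartOne E G)
  refine ⟨fun i => (extChartAt 𝓘(ℝ, E) (1 : G)).symm (x i), ?_, ?_⟩
  · have hsymm := (continuousAt_extChartAt_symm (I := 𝓘(ℝ, E)) (1 : G)).tendsto
    rw [extChartAt_to_inv] at hsymm
    exact hsymm.comp hx
  · refine (tendsto_const_nhds (x := v)).congr' ?_
    filter_upwards [hx.eventually extChartAt_target_mem_nhds_chartOne,
      hc.eventually_ne_atTop 0] with i hi hci
    rw [PartialEquiv.right_inv _ hi, add_sub_cancel_left, smul_inv_smul₀ hci]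

section C2

variable [LieGroup 𝓘(ℝ, E) 2 G]

variable (E G) in
theorem isLocalUnitalLaw_chartMul : IsLocalUnitalLaw (chartMul E G) (chartOne E G) where
  contDiffAt := by
    have hsymm : ContMDiffAt 𝓘(ℝ, E) 𝓘(ℝ, E) 2 (extChartAt 𝓘(ℝ, E) (1 : G)).symm (chartOne E G) :=
      (contMDiffOn_extChartAt_symm (1 : G)).contMDiffAt extChartAt_target_mem_nhds_chartOne
    have hmul : ContMDiffAt 𝓘(ℝ, E × E) 𝓘(ℝ, E) 2
        (fun p : E × E => (extChartAt 𝓘(ℝ, E) (1 : G)).symm p.1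
          * (extChartAt 𝓘(ℝ, E) (1 : G)).symm p.2) (chartOne E G, chartOne E G) :=
      (hsymm.comp (chartOne E G, chartOne E G) contDiffAt_fst.contMDiffAt).mul
        (hsymm.comp (chartOne E G, chartOne E G) contDiffAt_snd.contMDiffAt)
    refine contMDiffAt_iff_contDiffAt.1 (contMDiffAt_extChartAt.comp_of_eq hmul ?_)
    simp only [extChartAt_symm_chartOne, mul_one]
  right_unit := by
    filter_upwards [extChartAt_target_mem_nhds_chartOne] with x hx
    rw [chartMul, extChartAt_symm_chartOne, mul_one, PartialEquiv.right_inv _ hx]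
  left_unit := by
    filter_upwards [extChartAt_target_mem_nhds_chartOne] with x hx
    rw [chartMul, extChartAt_symm_chartOne, one_mul, PartialEquiv.right_inv _ hx]

theorem hasMFDerivAt_extChartAt_symm_chartOne :
    HasMFDerivAt 𝓘(ℝ, E) 𝓘(ℝ, E) (extChartAt 𝓘(ℝ, E) (1 : G)).symm (chartOne E G)
      (ContinuousLinearMap.id ℝ E) := by
  have : IsManifold 𝓘(ℝ, E) 1 G := IsManifold.of_le (n := 2) one_le_two
  have hid := mfderivWithin_range_extChartAt_symm (I := 𝓘(ℝ, E)) (x := (1 : G))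
  rw [ModelWithCorners.range_eq_univ, mfderivWithin_univ] at hid
  have hsymm : MDifferentiableAt 𝓘(ℝ, E) 𝓘(ℝ, E) (extChartAt 𝓘(ℝ, E) (1 : G)).symm
      (chartOne E G) :=
    ((contMDiffOn_extChartAt_symm (n := 1) (1 : G)).contMDiffAt
      extChartAt_target_mem_nhds_chartOne).mdifferentiableAt one_ne_zero
  exact hid ▸ hsymm.hasMFDerivAt

theorem hasFDerivAt_chartMul_right {x : E} (hx : x ∈ (extChartAt 𝓘(ℝ, E) (1 : G)).target) :
    HasFDerivAt (fun y => chartMul E G (x, y))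
      ((mfderiv 𝓘(ℝ, E) 𝓘(ℝ, E) (extChartAt 𝓘(ℝ, E) (1 : G))
          ((extChartAt 𝓘(ℝ, E) (1 : G)).symm x) : E →L[ℝ] E) ∘L
        (mfderiv 𝓘(ℝ, E) 𝓘(ℝ, E) (fun a : G => (extChartAt 𝓘(ℝ, E) (1 : G)).symm x * a) 1))
      (chartOne E G) := by
  have : IsManifold 𝓘(ℝ, E) 1 G := IsManifold.of_le (n := 2) one_le_two
  set e := extChartAt 𝓘(ℝ, E) (1 : G)
  have hmul : MDifferentiableAt 𝓘(ℝ, E) 𝓘(ℝ, E) (fun a : G => e.symm x * a) 1 :=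
    (contMDiff_mul_left (I := 𝓘(ℝ, E)) (n := 2)).contMDiffAt.mdifferentiableAt two_ne_zero
  have he : MDifferentiableAt 𝓘(ℝ, E) 𝓘(ℝ, E) e (e.symm x * 1) := by
    rw [mul_one]
    exact mdifferentiableAt_extChartAt ((extChartAt_source 𝓘(ℝ, E) (1 : G)) ▸ e.map_target hx)
  have hleft := HasMFDerivAt.comp (1 : G) he.hasMFDerivAt hmul.hasMFDerivAt
  have hchart : HasMFDerivAt 𝓘(ℝ, E) 𝓘(ℝ, E) (fun y => chartMul E G (x, y)) (chartOne E G) _ :=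
    HasMFDerivAt.comp (chartOne E G) (f := e.symm) (g := fun a => e (e.symm x * a)) (by
      rw [extChartAt_symm_chartOne]
      exact hleft) hasMFDerivAt_extChartAt_symm_chartOne
  rw [mul_one] at hchart
  exact hasMFDerivAt_iff_hasFDerivAt.1 hchart

theorem eventually_mpullbackWithin_mulInvariantVectorField (v : E) :
    ∀ᶠ x in 𝓝 (chartOne E G), VectorField.mpullbackWithin 𝓘(ℝ, E) 𝓘(ℝ, E)
      (extChartAt 𝓘(ℝ, E) (1 : G)).symm (mulInvariantVectorField (I := 𝓘(ℝ, E)) (G := G) v)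
        (Set.range 𝓘(ℝ, E)) x
      = fderiv ℝ (chartMul E G) (x, chartOne E G) (0, v) := by
  have : IsManifold 𝓘(ℝ, E) 1 G := IsManifold.of_le (n := 2) one_le_two
  have hinl : Tendsto (fun x => (x, chartOne E G)) (𝓝 (chartOne E G))
      (𝓝 (chartOne E G, chartOne E G)) := (Continuous.prodMk_left _).tendsto _
  filter_upwards [hinl.eventually (isLocalUnitalLaw_chartMul E G).eventually_differentiableAt,
    extChartAt_target_mem_nhds_chartOne] with x hdiff hx
  have hpartial : HasFDerivAt (fun y => chartMul E G (x, y))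
      (fderiv ℝ (chartMul E G) (x, chartOne E G) ∘L .inr ℝ E E) (chartOne E G) :=
    hdiff.hasFDerivAt.comp (chartOne E G) (hasFDerivAt_prodMk_right x (chartOne E G))
  have hinv := ContinuousLinearMap.inverse_eq
    (mfderivWithin_extChartAt_symm_comp_mfderiv_extChartAt (I := 𝓘(ℝ, E)) (x := (1 : G)) hx)
    (mfderiv_extChartAt_comp_mfderivWithin_extChartAt_symm (I := 𝓘(ℝ, E)) (x := (1 : G)) hx)
  rw [VectorField.mpullbackWithin_apply, hinv]
  exact congrArg (fun L : E →L[ℝ] E => L v) (hpartial.unique (hasFDerivAt_chartMul_right hx)).symm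

theorem lie_eq_mixedFDeriv_sub (X Y : GroupLieAlgebra 𝓘(ℝ, E) G) :
    ⁅X, Y⁆ = (mixedFDeriv (chartMul E G) (chartOne E G) X Y
      - mixedFDeriv (chartMul E G) (chartOne E G) Y X : E) := by
  have hX := eventually_mpullbackWithin_mulInvariantVectorField (E := E) (G := G) X
  have hY := eventually_mpullbackWithin_mulInvariantVectorField (E := E) (G := G) Y
  rw [GroupLieAlgebra.bracket_def, ← VectorField.mlieBracketWithin_univ,
    VectorField.mlieBracketWithin_apply, mfderiv_extChartAt_self, Set.preimage_univ,
    Set.univ_inter]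
  change (ContinuousLinearMap.id ℝ E).inverse _ = _
  rw [ContinuousLinearMap.inverse_id]
  rw [ModelWithCorners.range_eq_univ] at hX hY ⊢
  exact (congrFun (VectorField.lieBracketWithin_univ (𝕜 := ℝ) (E := E)) (chartOne E G)).trans <|
    (Filter.EventuallyEq.lieBracket_vectorField_eq (𝕜 := ℝ) hX hY).trans <|
    (isLocalUnitalLaw_chartMul E G).lieBracket_fderiv_inr X Y

theorem HasVelocity.commutator {ι : Type*} {l : Filter ι} {c : ι → ℝ} {g k : ι → G}
    {X Y : GroupLieAlgebra 𝓘(ℝ, E) G} (hg : HasVelocity l c g X) (hk : HasVelocity l c k Y)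
    (hc : Tendsto c l atTop) :
    HasVelocity l (fun i => c i ^ 2) (fun i => (k i * g i)⁻¹ * (g i * k i)) ⁅X, Y⁆ := by
  have : IsTopologicalGroup G := topologicalGroup_of_lieGroup 𝓘(ℝ, E) 2
  have hgk : Tendsto (fun i => g i * k i) l (𝓝 1) := by
    simpa only [mul_one] using hg.tendsto_one.mul hk.tendsto_one
  have hkg : Tendsto (fun i => k i * g i) l (𝓝 1) := by
    simpa only [mul_one] using hk.tendsto_one.mul hg.tendsto_one
  have hcomm : Tendsto (fun i => (k i * g i)⁻¹ * (g i * k i)) l (𝓝 1) := by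
    simpa only [inv_one, mul_one] using hkg.inv.mul hgk
  refine ⟨hcomm, ?_⟩
  have hleft : ∀ᶠ a in 𝓝 (1 : G),
      (extChartAt 𝓘(ℝ, E) (1 : G)).symm (extChartAt 𝓘(ℝ, E) (1 : G) a) = a :=
    eventually_of_mem (extChartAt_source_mem_nhds (1 : G)) fun _ => PartialEquiv.left_inv _
  rw [lie_eq_mixedFDeriv_sub]
  refine (isLocalUnitalLaw_chartMul E G).tendsto_sq_smul_commutator hc hg.tendsto_smul
    hk.tendsto_smul ((continuousAt_extChartAt (I := 𝓘(ℝ, E)) (1 : G)).tendsto.comp hcomm) ?_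
  filter_upwards [hg.tendsto_one.eventually hleft, hk.tendsto_one.eventually hleft,
    hkg.eventually hleft, hcomm.eventually hleft] with i hgi hki hkgi hcommi
  simp only [chartMul, hgi, hki, hkgi, hcommi, mul_inv_cancel_left]

end C2
end LieGroup

section Hilbert

variable {H : Type*} [NormedAddCommGroup H] [InnerProductSpace ℂ H] {ψ a b : H}

theorem re_inner_sub_self {u : H} (hψ : ‖ψ‖ = 1) (hu : ‖u‖ = 1) :
    (⟪ψ, u - ψ⟫_ℂ).re = -(‖u - ψ‖ ^ 2 / 2) := by
  have h := norm_sub_sq (𝕜 := ℂ) u ψ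
  rw [hu, hψ, inner_re_symm, RCLike.re_eq_complex_re] at h
  rw [inner_sub_right, inner_self_eq_one_of_norm_eq_one hψ, sub_re, one_re]
  linarith

theorem re_inner_eq_zero_of_tendsto_smul {ι : Type*} {l : Filter ι} [l.NeBot] {c : ι → ℝ}
    {u : ι → H} {w : H} (hψ : ‖ψ‖ = 1) (hu : ∀ i, ‖u i‖ = 1) (hc : Tendsto c l atTop)
    (h : Tendsto (fun i => c i • (u i - ψ)) l (𝓝 w)) : (⟪ψ, w⟫_ℂ).re = 0 := by
  have hre : Tendsto (fun i => (⟪ψ, c i • (u i - ψ)⟫_ℂ).re) l (𝓝 (⟪ψ, w⟫_ℂ).re) :=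
    (continuous_re.tendsto _).comp (tendsto_const_nhds.inner h)
  have hzero : Tendsto (fun i => -(⟪u i - ψ, c i • (u i - ψ)⟫_ℂ).re / 2) l (𝓝 0) := by
    simpa using (((continuous_re.tendsto _).comp
      ((tendsto_zero_of_tendsto_smul hc h).inner (𝕜 := ℂ) h)).neg).div_const 2
  refine tendsto_nhds_unique hre (hzero.congr fun i => ?_)
  rw [← coe_smul (c i), inner_smul_right, inner_smul_right, re_ofReal_mul, re_ofReal_mul,
    re_inner_sub_self hψ (hu i), ← RCLike.re_eq_complex_re, inner_self_eq_norm_sq]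
  ring

theorem orthNormSq_add (ψ a b : H) :
    orthNormSq ψ (a + b)
      = orthNormSq ψ a + orthNormSq ψ b + 2 * (⟪a, b⟫_ℂ - ⟪a, ψ⟫_ℂ * ⟪ψ, b⟫_ℂ).re := by
  have h := norm_add_sq (𝕜 := ℂ) ⟪ψ, a⟫_ℂ ⟪ψ, b⟫_ℂ
  rw [RCLike.inner_apply, inner_conj_symm, mul_comm ⟪ψ, b⟫_ℂ, RCLike.re_eq_complex_re] at h
  rw [orthNormSq, orthNormSq, orthNormSq, norm_add_sq (𝕜 := ℂ), inner_add_right, h, sub_re,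
    RCLike.re_eq_complex_re]
  ring

theorem half_add_sub_mul_inner_neg_I_smul (ha : (⟪ψ, a⟫_ℂ).re = 0) (hb : (⟪ψ, b⟫_ℂ).re = 0) :
    1 / 2 * (⟪-I • a, -I • b⟫_ℂ + ⟪-I • b, -I • a⟫_ℂ) - ⟪ψ, -I • a⟫_ℂ * ⟪ψ, -I • b⟫_ℂ
      = (((orthNormSq ψ (a + b) - orthNormSq ψ a - orthNormSq ψ b) / 2 : ℝ) : ℂ) := by
  have hskew : ⟪a, ψ⟫_ℂ = -⟪ψ, a⟫_ℂ := by
    rw [← inner_conj_symm]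
    exact Complex.ext (by rw [conj_re, neg_re, ha, neg_zero]) (by rw [conj_im, neg_im])
  have hreal : (((⟪a, ψ⟫_ℂ * ⟪ψ, b⟫_ℂ).re : ℝ) : ℂ) = ⟪a, ψ⟫_ℂ * ⟪ψ, b⟫_ℂ :=
    Complex.ext rfl (by simp [hskew, ha, hb])
  have hconj : ⟪a, b⟫_ℂ + ⟪b, a⟫_ℂ = 2 * ((⟪a, b⟫_ℂ).re : ℂ) := by
    rw [← inner_conj_symm b a, add_conj, ofReal_mul, ofReal_ofNat]
  have hpolar : (orthNormSq ψ (a + b) - orthNormSq ψ a - orthNormSq ψ b) / 2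
      = (⟪a, b⟫_ℂ).re - (⟪a, ψ⟫_ℂ * ⟪ψ, b⟫_ℂ).re := by
    rw [orthNormSq_add, sub_re]
    ring
  rw [hpolar, ofReal_sub, hreal, hskew]
  simp only [inner_smul_left, inner_smul_right, map_neg, conj_I, neg_neg]
  linear_combination (1 / 2 : ℂ) * hconj - (1 / 2 * (⟪a, b⟫_ℂ + ⟪b, a⟫_ℂ)
    + ⟪ψ, a⟫_ℂ * ⟪ψ, b⟫_ℂ) * I_mul_I

theorem eq_of_forall_exp_ofReal_mul_eq {z z' : ℂ}
    (h : ∀ τ : ℝ, exp (τ * z) = exp (τ * z')) : z = z' := by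
  have hderiv : ∀ z : ℂ, HasDerivAt (fun τ : ℝ => exp (τ * z)) z 0 := fun z => by
    simpa using ((ofRealCLM.hasDerivAt (x := (0 : ℝ))).mul_const z).cexp
  exact (hderiv z).unique ((hderiv z').congr_of_eventuallyEq (Eventually.of_forall h))

end Hilbert

section Orbit

variable {E : Type*} [NormedAddCommGroup E] [NormedSpace ℝ E]
  {G : Type v} [Group G] [TopologicalSpace G] [ChartedSpace E G]
  {S : System.{u, v} G} {T : System.{w, v} G} {ψ : S.carrier} {φ : T.carrier} {R : ℝ}

variable (E) in
/-- The derivative at the identity of the orbit map of `ψ`; its value at `X` is `i L_X ψ`. -/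
def orbitDeriv (S : System.{u, v} G) (ψ : S.carrier) :
    GroupLieAlgebra 𝓘(ℝ, E) G →L[ℝ] S.carrier :=
  mfderiv 𝓘(ℝ, E) 𝓘(ℝ, S.carrier) (fun g : G => S.U g ψ) 1

theorem expect_eq_neg_I_mul_inner (X : GroupLieAlgebra 𝓘(ℝ, E) G) :
    expect S X ψ = -I * ⟪ψ, orbitDeriv E S ψ X⟫_ℂ :=
  inner_smul_right _ _ _

theorem inner_orbitDeriv_smul (τ : ℝ) (X : GroupLieAlgebra 𝓘(ℝ, E) G) :
    ⟪ψ, orbitDeriv E S ψ (τ • X)⟫_ℂ = τ * ⟪ψ, orbitDeriv E S ψ X⟫_ℂ := by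
  rw [map_smul, ← coe_smul, inner_smul_right]

namespace InGeneratorDomain

theorem tendsto_smul {ι : Type*} {l : Filter ι} {c : ι → ℝ} {g : ι → G}
    {X : GroupLieAlgebra 𝓘(ℝ, E) G} (h : InGeneratorDomain E S ψ) (hg : HasVelocity l c g X)
    (hc : Tendsto c l atTop) :
    Tendsto (fun i => c i • (S.U (g i) ψ - ψ)) l (𝓝 (orbitDeriv E S ψ X)) := by
  let L : E →L[ℝ] S.carrier := orbitDeriv E S ψ
  have hderiv : HasFDerivWithinAt (fun x => S.U ((extChartAt 𝓘(ℝ, E) (1 : G)).symm x) ψ) L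
      Set.univ (chartOne E G) :=
    ModelWithCorners.range_eq_univ 𝓘(ℝ, E) ▸ (MDifferentiableAt.hasMFDerivAt h).2
  have hlim := hderiv.lim (tendsto_zero_of_tendsto_smul (V := E) hc hg.tendsto_smul)
    (Eventually.of_forall fun _ => Set.mem_univ _) hg.tendsto_smul
  refine hlim.congr' ?_
  filter_upwards [hg.tendsto_one.eventually
    (extChartAt_source_mem_nhds (I := 𝓘(ℝ, E)) (1 : G))] with i hi
  rw [add_sub_cancel, extChartAt_symm_chartOne, map_one, PartialEquiv.left_inv _ hi]
  rfl

theorem re_inner_orbitDeriv (h : InGeneratorDomain E S ψ) (hψ : ‖ψ‖ = 1)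
    (X : GroupLieAlgebra 𝓘(ℝ, E) G) : (⟪ψ, orbitDeriv E S ψ X⟫_ℂ).re = 0 := by
  obtain ⟨g, hg⟩ := exists_hasVelocity (tendsto_natCast_atTop_atTop (R := ℝ)) X
  exact re_inner_eq_zero_of_tendsto_smul hψ (fun N => by rw [LinearIsometryEquiv.norm_map, hψ])
    tendsto_natCast_atTop_atTop (h.tendsto_smul hg tendsto_natCast_atTop_atTop)

theorem covMatrix_apply (h : InGeneratorDomain E S ψ) (hψ : ‖ψ‖ = 1) {κ : Type*}
    (b : Module.Basis κ ℝ (GroupLieAlgebra 𝓘(ℝ, E) G)) (k l : κ) :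
    covMatrix S b ψ k l = (((orthNormSq ψ (orbitDeriv E S ψ (b k + b l))
      - orthNormSq ψ (orbitDeriv E S ψ (b k))
      - orthNormSq ψ (orbitDeriv E S ψ (b l))) / 2 : ℝ) : ℂ) := by
  rw [map_add]
  exact half_add_sub_mul_inner_neg_I_smul (h.re_inner_orbitDeriv hψ (b k))
    (h.re_inner_orbitDeriv hψ (b l))

end InGeneratorDomain

theorem AsymptoticallyConvertible.mul_orthNormSq_orbitDeriv_le {hψ : ‖ψ‖ = 1} {hφ : ‖φ‖ = 1}
    (h : AsymptoticallyConvertible S T ψ hψ φ hφ R) (hR : 0 ≤ R) (hSψ : InGeneratorDomain E S ψ)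
    (hTφ : InGeneratorDomain E T φ) (X : GroupLieAlgebra 𝓘(ℝ, E) G) :
    R * orthNormSq φ (orbitDeriv E T φ X) ≤ orthNormSq ψ (orbitDeriv E S ψ X) := by
  obtain ⟨f, hf⟩ := h.exists_isAsymptoticFactor
  obtain ⟨g, hg⟩ := exists_hasVelocity tendsto_sqrt_natCast_atTop X
  exact hf.mul_orthNormSq_le hψ hφ hR (hSψ.tendsto_smul hg tendsto_sqrt_natCast_atTop)
    (hTφ.tendsto_smul hg tendsto_sqrt_natCast_atTop)

theorem IsAsymptoticFactor.exp_inner_orbitDeriv_lie_eq [LieGroup 𝓘(ℝ, E) 2 G]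
    {f : ℕ → G → ℂ} (hf : IsAsymptoticFactor S T ψ φ R f) (hψ : ‖ψ‖ = 1) (hφ : ‖φ‖ = 1)
    (hR : 0 ≤ R) (hSψ : InGeneratorDomain E S ψ) (hTφ : InGeneratorDomain E T φ)
    (hvar : ∀ X : GroupLieAlgebra 𝓘(ℝ, E) G,
      orthNormSq ψ (orbitDeriv E S ψ X) = R * orthNormSq φ (orbitDeriv E T φ X))
    (X Y : GroupLieAlgebra 𝓘(ℝ, E) G) :
    exp ⟪ψ, orbitDeriv E S ψ ⁅X, Y⁆⟫_ℂ = exp (R * ⟪φ, orbitDeriv E T φ ⁅X, Y⁆⟫_ℂ) := by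
  have hsqrt := tendsto_sqrt_natCast_atTop
  obtain ⟨g, hg⟩ := exists_hasVelocity hsqrt X
  obtain ⟨k, hk⟩ := exists_hasVelocity hsqrt Y
  have hfactor : ∀ {g : ℕ → G} {X : GroupLieAlgebra 𝓘(ℝ, E) G},
      HasVelocity atTop (fun N : ℕ => √(N : ℝ)) g X →
        Tendsto (fun N => ‖f N (g N)‖) atTop (𝓝 1) := fun {_ X} hg =>
    hf.tendsto_norm_one hψ hφ hR (hSψ.tendsto_smul hg hsqrt) (hTφ.tendsto_smul hg hsqrt) (hvar X)
  have hcomm := hg.commutator hk hsqrt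
  simp only [Real.sq_sqrt (Nat.cast_nonneg _)] at hcomm
  exact hf.exp_inner_eq hψ hφ hR (hfactor hg) (hfactor hk)
    (hSψ.tendsto_smul hcomm tendsto_natCast_atTop_atTop)
    (hTφ.tendsto_smul hcomm tendsto_natCast_atTop_atTop)

namespace ReversiblyConvertible

variable {hψ : ‖ψ‖ = 1} {hφ : ‖φ‖ = 1}

theorem orthNormSq_orbitDeriv (h : ReversiblyConvertible S T ψ hψ φ hφ R) (hR : 0 < R)
    (hSψ : InGeneratorDomain E S ψ) (hTφ : InGeneratorDomain E T φ)
    (X : GroupLieAlgebra 𝓘(ℝ, E) G) :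
    orthNormSq ψ (orbitDeriv E S ψ X) = R * orthNormSq φ (orbitDeriv E T φ X) :=
  ((inv_mul_le_iff₀ hR).1
    (h.2.mul_orthNormSq_orbitDeriv_le (inv_pos.2 hR).le hTφ hSψ X)).antisymm
    (h.1.mul_orthNormSq_orbitDeriv_le hR.le hSψ hTφ X)

theorem covMatrix_eq (h : ReversiblyConvertible S T ψ hψ φ hφ R) (hR : 0 < R)
    (hSψ : InGeneratorDomain E S ψ) (hTφ : InGeneratorDomain E T φ) {κ : Type*}
    (b : Module.Basis κ ℝ (GroupLieAlgebra 𝓘(ℝ, E) G)) :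
    covMatrix S b ψ = R • covMatrix T b φ := by
  ext k l
  rw [Matrix.smul_apply, hSψ.covMatrix_apply hψ, hTφ.covMatrix_apply hφ]
  simp only [h.orthNormSq_orbitDeriv hR hSψ hTφ]
  rw [real_smul, ← ofReal_mul, mul_div_assoc', mul_sub, mul_sub]

variable [CompleteSpace E] [LieGroup 𝓘(ℝ, E) (minSmoothness ℝ 3) G]

theorem inner_orbitDeriv_lie_eq (h : ReversiblyConvertible S T ψ hψ φ hφ R) (hR : 0 < R)
    (hSψ : InGeneratorDomain E S ψ) (hTφ : InGeneratorDomain E T φ)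
    (X Y : GroupLieAlgebra 𝓘(ℝ, E) G) :
    ⟪ψ, orbitDeriv E S ψ ⁅X, Y⁆⟫_ℂ = R * ⟪φ, orbitDeriv E T φ ⁅X, Y⁆⟫_ℂ := by
  have : LieGroup 𝓘(ℝ, E) 2 G := by
    refine LieGroup.of_le (n := minSmoothness ℝ 3) ?_
    rw [minSmoothness_of_isRCLikeNormedField]
    norm_num
  obtain ⟨f, hf⟩ := h.1.exists_isAsymptoticFactor
  -- The limits only determine both sides modulo `2 π i`; rescaling `X` removes the ambiguity.
  refine eq_of_forall_exp_ofReal_mul_eq fun τ => ?_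
  have hexp := hf.exp_inner_orbitDeriv_lie_eq hψ hφ hR.le hSψ hTφ
    (h.orthNormSq_orbitDeriv hR hSψ hTφ) (τ • X) Y
  rwa [smul_lie, inner_orbitDeriv_smul, inner_orbitDeriv_smul, mul_left_comm] at hexp

theorem expect_eq_of_mem_commutator (h : ReversiblyConvertible S T ψ hψ φ hφ R) (hR : 0 < R)
    (hSψ : InGeneratorDomain E S ψ) (hTφ : InGeneratorDomain E T φ)
    {X : GroupLieAlgebra 𝓘(ℝ, E) G} (hX : X ∈ (⁅(⊤ : LieIdeal ℝ (GroupLieAlgebra 𝓘(ℝ, E) G)),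
      (⊤ : LieIdeal ℝ (GroupLieAlgebra 𝓘(ℝ, E) G))⁆ : LieIdeal ℝ (GroupLieAlgebra 𝓘(ℝ, E) G))) :
    expect S X ψ = R * expect T X φ := by
  rw [expect_eq_neg_I_mul_inner, expect_eq_neg_I_mul_inner, mul_left_comm]
  congr 1
  rw [← LieSubmodule.mem_toSubmodule, LieSubmodule.lieIdeal_oper_eq_linear_span'] at hX
  induction hX using Submodule.span_induction with
  | mem X hX =>
    obtain ⟨Y, -, Z, -, rfl⟩ := hX
    exact h.inner_orbitDeriv_lie_eq hR hSψ hTφ Y Z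
  | zero => rw [map_zero, map_zero, inner_zero_right, inner_zero_right, mul_zero]
  | add X Y _ _ hX hY =>
    rw [map_add, map_add, inner_add_right, inner_add_right, hX, hY, mul_add]
  | smul τ X _ hX => rw [inner_orbitDeriv_smul, inner_orbitDeriv_smul, hX, mul_left_comm]

end ReversiblyConvertible

end Orbit

end

end Asymmetry

theorem theorem5_general
    {E : Type*} [NormedAddCommGroup E] [NormedSpace ℝ E] [CompleteSpace E]
    {G : Type*} [Group G] [TopologicalSpace G] [ChartedSpace E G]
    [LieGroup 𝓘(ℝ, E) (minSmoothness ℝ 3) G]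
    (S : Asymmetry.System G) (T : Asymmetry.System G)
    (ψ : S.carrier) (hψ : ‖ψ‖ = 1) (φ : T.carrier) (hφ : ‖φ‖ = 1) (R : ℝ) (hR : 0 < R)
    (h : Asymmetry.ReversiblyConvertible S T ψ hψ φ hφ R) :
    Asymmetry.sym S (Asymmetry.pureState ψ hψ) = Asymmetry.sym T (Asymmetry.pureState φ hφ) ∧
    (Asymmetry.InGeneratorDomain E S ψ → Asymmetry.InGeneratorDomain E T φ →
      (∀ {κ : Type*} (b : Module.Basis κ ℝ (GroupLieAlgebra 𝓘(ℝ, E) G)),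
        Asymmetry.covMatrix S b ψ = R • Asymmetry.covMatrix T b φ) ∧
      (∀ X ∈ (⁅(⊤ : LieIdeal ℝ (GroupLieAlgebra 𝓘(ℝ, E) G)),
          (⊤ : LieIdeal ℝ (GroupLieAlgebra 𝓘(ℝ, E) G))⁆ :
            LieIdeal ℝ (GroupLieAlgebra 𝓘(ℝ, E) G)),
        Asymmetry.expect S X ψ = R * Asymmetry.expect T X φ)) :=
  ⟨h.sym_eq hR, fun hSψ hTφ =>
    ⟨fun b => h.covMatrix_eq hR hSψ hTφ b, fun _ hX => h.expect_eq_of_mem_commutator hR hSψ hTφ hX⟩⟩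

theorem theorem5
    {d : ℕ}
    {G : Type*} [Group G] [TopologicalSpace G] [ChartedSpace (EuclideanSpace ℝ (Fin d)) G]
    [LieGroup (𝓡 d) ∞ G] [CompactSpace G] [T2Space G]
    (S : Asymmetry.System G) (T : Asymmetry.System G)
    (hS : ∀ v : S.carrier, Continuous fun g => S.U g v)
    (hT : ∀ v : T.carrier, Continuous fun g => T.U g v)
    (ψ : S.carrier) (hψ : ‖ψ‖ = 1) (φ : T.carrier) (hφ : ‖φ‖ = 1)
    (R : ℝ) (hR : 0 < R)
    (h : Asymmetry.ReversiblyConvertible S T ψ hψ φ hφ R) :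
    Asymmetry.sym S (Asymmetry.pureState ψ hψ) = Asymmetry.sym T (Asymmetry.pureState φ hφ) ∧
    (Asymmetry.InGeneratorDomain (EuclideanSpace ℝ (Fin d)) S ψ → Asymmetry.InGeneratorDomain (EuclideanSpace ℝ (Fin d)) T φ →
      (∀ {κ : Type*} (b : Module.Basis κ ℝ (GroupLieAlgebra (𝓡 d) G)),
        Asymmetry.covMatrix S b ψ = R • Asymmetry.covMatrix T b φ) ∧
      (∀ X ∈ (⁅(⊤ : LieIdeal ℝ (GroupLieAlgebra (𝓡 d) G)),
          (⊤ : LieIdeal ℝ (GroupLieAlgebra (𝓡 d) G))⁆ :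
            LieIdeal ℝ (GroupLieAlgebra (𝓡 d) G)),
        Asymmetry.expect S X ψ = R * Asymmetry.expect T X φ)) :=
  theorem5_general S T ψ hψ φ hφ R hR h
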